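/- Let $1<p<q$ be real, let $\rho,\mu,v_p,v_q:\mathbb{R}^3\to(0,\infty)$ be radially symmetric $C^2$-functions, and let $M:\mathbb{R}^3\to\mathbb{R}^{3\times3}$ be an arbitrary matrix function. Consider the curl-curl wave equation $$\rho(x)\mathbf u_{tt}+\nabla\times\big(M(x)\nabla\times\mathbf u\big)+\mu(x)\mathbf u+v_p(x)|\mathbf u|^{p-1}\mathbf u+v_q(x)|\mathbf u|^{q-1}\mathbf u=0,\qquad (x,t)\in\mathbb{R}^3\times\mathbb{R}.\tag{1}$$ Put $\sigma(x)=(\mu(x)/\rho(x))^{1/2}$, $\tau(x)=(\mu(x)/v_q(x))^{1/(q-1)}$ and $T=2\pi\sigma(0)$. Assume (V) $v_p(x)=\left(\mu(x)^{q-p}/v_q(x)^{1-p}\right)^{1/(q-1)}$ for all $x\in\mathbb{R}^3$; (H1) $\sigma(0)\sigma(x)<1$ for all $x\in\mathbb{R}^3\setminus\{0\}$; (H2) the function $U(x)=|1-\sigma(0)\sigma(x)|^{1/(q-1)}$ satisfies $U(x)\to0$, $\nabla U(x)\to0$ and $D^2U(x)\to0$ as $x\to0$, $x\neq0$; (H3)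 $\sup_{x\in\mathbb{R}^3}|1-\sigma(0)\sigma(x)|e^{\gamma(q-1)|x|}<\infty$ for a given $\gamma>0$; (H4) $\sup_{x\in\mathbb{R}^3}\tau(x)<\infty$. By a breather (of period $T$ and rate $\gamma$) we mean a function $\mathbf u\in C^2(\mathbb{R}^3\times\mathbb{R};\mathbb{R}^3)$, not identically zero, that satisfies (1) pointwise (with $M\nabla\times\mathbf u$ differentiable in $x$), is $T$-periodic in $t$, and satisfies $\sup_{\mathbb{R}^3\times\mathbb{R}}|\mathbf u(x,t)|e^{\gamma|x|}<\infty$. Then $T=2\pi\sqrt{\rho(0)/\mu(0)}$, and there exists a breather $\mathbf u$ of the form $\mathbf u(x,t)=y(|x|,t)\,x/|x|$ for $x\ne0$, $\mathbf u(0,t)=0$, with $y\in C^2([0,\infty)\times\mathbb{R})$. Moreover, for every radially symmetric $C^2$-function $b:\mathbb{R}^3\to\mathbb{R}$ the phase-shifted function $\mathbf u_b(x,t)=\mathbf u(x,t+b(x))$ is again a breather (of the same period and rate), and the set of all functions $\mathbf u_b$ so obtained has at least the cardinality of the continuum. -/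

import Mathlib

open scoped ContDiff Topology

noncomputable section

namespace CurlCurl

/-- Three-dimensional Euclidean space. -/
abbrev E3 : Type := EuclideanSpace ℝ (Fin 3)

/-- A function on `ℝ³` is radially symmetric if its value depends only on `‖x‖`. -/
def RadiallySymmetric (f : E3 → ℝ) : Prop :=
  ∀ x y : E3, ‖x‖ = ‖y‖ → f x = f y

/-- The partial derivative `∂ⱼ Fᵢ` of a vector field at `x`. -/
def partialDeriv (F : E3 → E3) (j i : Fin 3) (x : E3) : ℝ :=
  (fderiv ℝ F x (EuclideanSpace.single j 1)) i

/-- The curl `∇ × F` of a vector field on `ℝ³`. -/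
def curl (F : E3 → E3) (x : E3) : E3 :=
  !₂[partialDeriv F 1 2 x - partialDeriv F 2 1 x,
     partialDeriv F 2 0 x - partialDeriv F 0 2 x,
     partialDeriv F 0 1 x - partialDeriv F 1 0 x]

/-- The field `M(x) ∇ × F`. -/
def matCurl (M : E3 → Matrix (Fin 3) (Fin 3) ℝ) (F : E3 → E3) (x : E3) : E3 :=
  Matrix.toEuclideanLin (M x) (curl F x)

/-- `u ∈ C²(ℝ³ × ℝ)` solves
`ρ u_tt + ∇ × (M ∇ × u) + μ u + v_p |u|^(p-1) u + v_q |u|^(q-1) u = 0` pointwise on `ℝ³ × ℝ`;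
the field `M ∇ × u` is required to be differentiable, so that its curl is a genuine one. -/
structure IsClassicalSolution (ρ μ vp vq : E3 → ℝ) (M : E3 → Matrix (Fin 3) (Fin 3) ℝ) (p q : ℝ)
    (u : E3 → ℝ → E3) : Prop where
  contDiff : ContDiff ℝ 2 (fun z : E3 × ℝ => u z.1 z.2)
  differentiable_matCurl : ∀ t : ℝ, Differentiable ℝ (matCurl M (fun x => u x t))
  equation : ∀ (x : E3) (t : ℝ),
    ρ x • iteratedDeriv 2 (u x) t + curl (matCurl M (fun z => u z t)) x + μ x • u x t
      + (vp x * ‖u x t‖ ^ (p - 1)) • u x t + (vq x * ‖u x t‖ ^ (q - 1)) • u x t = 0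

/-- A `T`-periodic breather with exponential localization rate `γ`: a classical solution, not
identically zero, `T`-periodic in time, with `sup |u(x,t)| e^(γ|x|) < ∞`. -/
structure IsBreather (ρ μ vp vq : E3 → ℝ) (M : E3 → Matrix (Fin 3) (Fin 3) ℝ) (p q T γ : ℝ)
    (u : E3 → ℝ → E3) : Prop where
  isClassicalSolution : IsClassicalSolution ρ μ vp vq M p q u
  nontrivial : ∃ (x : E3) (t : ℝ), u x t ≠ 0
  periodic : ∀ x : E3, Function.Periodic (u x) T
  localized : BddAbove (Set.range fun z : E3 × ℝ => ‖u z.1 z.2‖ * Real.exp (γ * ‖z.1‖))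

/-- `τ = (μ / v_q)^(1/(q-1))`. -/
def tau (μ vq : E3 → ℝ) (q : ℝ) (x : E3) : ℝ :=
  (μ x / vq x) ^ (1 / (q - 1))

/-- `σ = (μ / ρ)^(1/2)`. -/
def sigma (ρ μ : E3 → ℝ) (x : E3) : ℝ :=
  √(μ x / ρ x)

/-- `U(x) → 0` in the `C²`-sense as `x → 0`: `U`, `∇U` and `D²U` tend to `0` as `x → 0`,
`x ≠ 0`. -/
def TendstoZeroC2 (U : E3 → ℝ) : Prop :=
  Filter.Tendsto U (𝓝[≠] 0) (𝓝 0) ∧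
  Filter.Tendsto (fderiv ℝ U) (𝓝[≠] 0) (𝓝 0) ∧
  Filter.Tendsto (fderiv ℝ (fderiv ℝ U)) (𝓝[≠] 0) (𝓝 0)

/-- The phase-shifted field `u_b(x,t) = u(x, t + b(x))`. -/
def phaseShift (u : E3 → ℝ → E3) (b : E3 → ℝ) : E3 → ℝ → E3 :=
  fun x t => u x (t + b x)

end CurlCurl

end

/-! A radial field `y(|x|,t) x/|x|` has symmetric Jacobian, hence no curl, so the term with `M`
disappears and the equation becomes an ODE in `t` for each fixed `x`. Put `y = τ(x) w(σ(x) t)`.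
Since `ρ σ² = μ`, `v_q τ^(q-1) = μ` and, by (V), `v_p τ^(p-1) = μ`, every `x ≠ 0` gives the same
oscillator `w'' + w + |w|^(p-1) w + |w|^(q-1) w = 0`. The remaining freedom is the amplitude `R(x)`
of the orbit; it is fixed by requiring the period of `w` to be `2π σ(x)`, so that `y` has period
`2π`. (H2) forces `σ(0) = 1`, whence `T = 2π`.

In the coordinate `w = R sin θ`, conservation of energy gives `θ' = S`, a positive function of `θ`
and of `(R^((p-1)/2), R^((q-p)/2))`. The period `∫ dθ / S` decreases strictly from `2π` to `0` on
`[0,∞)`, so each value `2π σ(x)` with `0 < σ(x) ≤ 1` is attained exactly once. Moreover `2π - period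
= R^(p-1) · defect` and `period' = -R^(p-2) · rate`, where `defect` and `rate` are positive `C²`
functions of those two powers.

The difficulty is `C²` regularity at `x = 0`, where `R = 0`, the powers of `R` need not be
differentiable, and `x/|x|` is singular. It is overcome by carrying functions that vanish at `x = 0`
together with two derivatives (`Flat₂`). `U = |1-σ|^(1/(q-1))` is such a function by (H2). `R`
inherits the property through `U ∇R = B(R) ∇U`, with `R ≤ U` near the origin and the inequality
`|∇U|² ≤ ε U` for nonnegative flat functions (`flat₂_of_smul_fderiv`, `flat₂_amplitude`). The
property survives multiplication by functions of the powers of `R` (`Flat₂.smul_powers`) and by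
`x_i/|x|` (`Flat₂.unitCoord_smul`).

Decay follows from `R^(q-1) ≤ C (1-σ)`, valid because `R` is bounded. Radial phase shifts keep the
field radial, and time does not enter the equation explicitly, so the whole argument applies to
every shifted field. Constant shifts, observed at one point `x ≠ 0`, already give a continuum of
fields. -/

open scoped ContDiff Topology

noncomputable section

namespace CurlCurl

/-! ### Parametric primitives and local inverses -/

section ParametricIntegral

variable {E G : Type*} [NormedAddCommGroup E] [NormedSpace ℝ E] [FiniteDimensional ℝ E]
  [NormedAddCommGroup G] [NormedSpace ℝ G]

/-- Differentiation under the integral sign for a jointly continuous derivative. -/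
theorem hasFDerivAt_integral_of_continuous {F : E → ℝ → G} {F' : E → ℝ → E →L[ℝ] G}
    (hF : Continuous (Function.uncurry F)) (hF' : Continuous (Function.uncurry F'))
    (hd : ∀ z φ, HasFDerivAt (fun z => F z φ) (F' z φ) z) (a b : ℝ) (z : E) :
    HasFDerivAt (fun z => ∫ φ in a..b, F z φ) (∫ φ in a..b, F' z φ) z := by
  obtain ⟨C, hC⟩ := ((isCompact_closedBall z 1).prod isCompact_uIcc).exists_bound_of_continuousOn
    (f := Function.uncurry F') (s := Metric.closedBall z 1 ×ˢ Set.uIcc a b) hF'.continuousOn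
  refine intervalIntegral.hasFDerivAt_integral_of_dominated_of_fderiv_le
    (Metric.closedBall_mem_nhds z one_pos) (bound := fun _ => C) ?_ ?_ ?_ ?_ ?_ ?_
  · exact Filter.Eventually.of_forall fun w =>
      (show Continuous (F w) from hF.comp (Continuous.prodMk_right w)).aestronglyMeasurable
  · exact (show Continuous (F z) from hF.comp (Continuous.prodMk_right z)).intervalIntegrable _ _
  · exact (show Continuous (F' z) from hF'.comp (Continuous.prodMk_right z)).aestronglyMeasurable
  · exact Filter.Eventually.of_forall fun t ht w hw =>
      hC (w, t) ⟨hw, Set.uIoc_subset_uIcc ht⟩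
  · exact intervalIntegrable_const
  · exact Filter.Eventually.of_forall fun t _ w _ => hd w t

/-- Derivative of a parametric primitive, jointly in the parameter and the end point. -/
theorem hasFDerivAt_primitive_of_continuous [CompleteSpace G] {F : E → ℝ → G}
    {F' : E → ℝ → E →L[ℝ] G}
    (hF : Continuous (Function.uncurry F)) (hF' : Continuous (Function.uncurry F'))
    (hd : ∀ z φ, HasFDerivAt (fun z => F z φ) (F' z φ) z) (w : E × ℝ) :
    HasFDerivAt (fun w : E × ℝ => ∫ φ in (0 : ℝ)..w.2, F w.1 φ)
      ((∫ φ in (0 : ℝ)..w.2, F' w.1 φ).coprod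
        (ContinuousLinearMap.toSpanSingleton ℝ (F w.1 w.2))) w := by
  obtain ⟨z, θ⟩ := w
  have hint : ∀ (z : E) (a b : ℝ), IntervalIntegrable (F z) MeasureTheory.volume a b :=
    fun z a b => (show Continuous (F z) from
      hF.comp (Continuous.prodMk_right z)).intervalIntegrable _ _
  have h1 : HasFDerivAt (fun w : E × ℝ => ∫ φ in (0 : ℝ)..θ, F w.1 φ)
      ((∫ φ in (0 : ℝ)..θ, F' z φ).comp (ContinuousLinearMap.fst ℝ E ℝ)) (z, θ) :=
    HasFDerivAt.comp (g := fun z => ∫ φ in (0 : ℝ)..θ, F z φ) (z, θ)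
      (hasFDerivAt_integral_of_continuous hF hF' hd 0 θ z) hasFDerivAt_fst
  -- The interval is split at the fixed end point `θ`. On the short piece from `θ` to `w.2`, joint
  -- continuity replaces the integrand by the constant `F z θ`, with an error `ε |w.2 - θ|`.
  have h2 : HasFDerivAt (fun w : E × ℝ => ∫ φ in θ..w.2, F w.1 φ)
      ((ContinuousLinearMap.toSpanSingleton ℝ (F z θ)).comp (ContinuousLinearMap.snd ℝ E ℝ))
      (z, θ) := by
    rw [hasFDerivAt_iff_isLittleO, Asymptotics.isLittleO_iff]
    intro ε hε
    obtain ⟨δ, hδ, hball⟩ := Metric.continuousAt_iff.1 (hF.continuousAt (x := (z, θ))) ε hε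
    filter_upwards [Metric.ball_mem_nhds (z, θ) hδ] with v hv
    have hv' : dist v.1 z < δ ∧ dist v.2 θ < δ := by
      simpa [Prod.dist_eq] using hv
    have e : (∫ φ in θ..v.2, F v.1 φ) - (v.2 - θ) • F z θ
        = ∫ φ in θ..v.2, (F v.1 φ - F z θ) := by
      rw [intervalIntegral.integral_sub (hint _ _ _) intervalIntegrable_const]
      simp
    have := intervalIntegral.norm_integral_le_of_norm_le_const (a := θ) (b := v.2)
      (f := fun φ => F v.1 φ - F z θ) (C := ε) (by
        intro φ hφ
        have hφ' : dist φ θ < δ := by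
          refine lt_of_le_of_lt ?_ hv'.2
          rw [Real.dist_eq, Real.dist_eq]
          exact Set.abs_sub_left_of_mem_uIcc (Set.uIoc_subset_uIcc hφ)
        have := hball (x := (v.1, φ)) (by simp [Prod.dist_eq, hv'.1, hφ'])
        rw [dist_eq_norm] at this
        exact this.le)
    simp only [intervalIntegral.integral_same, sub_zero, ContinuousLinearMap.comp_apply,
      ContinuousLinearMap.toSpanSingleton_apply, ContinuousLinearMap.coe_snd', Prod.snd_sub]
    rw [e]
    refine this.trans (mul_le_mul_of_nonneg_left ?_ hε.le)
    exact norm_snd_le (v - (z, θ))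
  have h3 := h1.add h2
  have e1 : (fun w : E × ℝ => ∫ φ in (0 : ℝ)..w.2, F w.1 φ) =
      (fun w : E × ℝ => ∫ φ in (0 : ℝ)..θ, F w.1 φ) + fun w : E × ℝ => ∫ φ in θ..w.2, F w.1 φ := by
    ext w
    exact (intervalIntegral.integral_add_adjacent_intervals (hint _ _ _) (hint _ _ _)).symm
  rw [e1]
  exact h3.congr_fderiv (by ext <;> simp)

theorem continuous_primitive_of_continuous {E : Type*} [TopologicalSpace E]
    [FirstCountableTopology E] {F : E → ℝ → G}
    (hF : Continuous (Function.uncurry F)) :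
    Continuous (fun w : E × ℝ => ∫ φ in (0 : ℝ)..w.2, F w.1 φ) := by
  refine intervalIntegral.continuous_parametric_intervalIntegral_of_continuous
    (f := fun (w : E × ℝ) φ => F w.1 φ) (s := fun w : E × ℝ => w.2) ?_ continuous_snd
  exact hF.comp ((continuous_fst.comp continuous_fst).prodMk continuous_snd)

theorem contDiff_one_of_hasFDerivAt {V F : Type*} [NormedAddCommGroup V] [NormedSpace ℝ V]
    [NormedAddCommGroup F] [NormedSpace ℝ F] {f : V → F} {f' : V → V →L[ℝ] F}
    (h : ∀ z, HasFDerivAt f (f' z) z) (hf' : Continuous f') : ContDiff ℝ 1 f := by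
  rw [contDiff_one_iff_fderiv]
  refine ⟨fun z => (h z).differentiableAt, ?_⟩
  rwa [show fderiv ℝ f = f' from funext fun z => (h z).fderiv]

theorem contDiff_two_of_hasFDerivAt {V F : Type*} [NormedAddCommGroup V] [NormedSpace ℝ V]
    [NormedAddCommGroup F] [NormedSpace ℝ F] {f : V → F} {f' : V → V →L[ℝ] F}
    (h : ∀ z, HasFDerivAt f (f' z) z) (hf' : ContDiff ℝ 1 f') : ContDiff ℝ 2 f := by
  rw [show (2 : WithTop ℕ∞) = 1 + 1 from one_add_one_eq_two.symm, contDiff_succ_iff_fderiv]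
  refine ⟨fun z => (h z).differentiableAt, by simp, ?_⟩
  rwa [show fderiv ℝ f = f' from funext fun z => (h z).fderiv]

variable {H : Type*} [NormedAddCommGroup H] [NormedSpace ℝ H] [CompleteSpace G]

/-- The two blocks of the derivative are the primitive of the parameter derivative and the integrand
at the end point; both are continuous. -/
theorem contDiff_one_primitive {F : E → ℝ → G} (hF : ContDiff ℝ 1 (Function.uncurry F)) :
    ContDiff ℝ 1 (fun w : E × ℝ => ∫ φ in (0 : ℝ)..w.2, F w.1 φ) := by
  have hF' : Continuous (Function.uncurry fun z φ =>
      (fderiv ℝ (Function.uncurry F) (z, φ)).comp (ContinuousLinearMap.inl ℝ E ℝ)) :=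
    (hF.continuous_fderiv one_ne_zero).clm_comp continuous_const
  refine contDiff_one_of_hasFDerivAt (hasFDerivAt_primitive_of_continuous
    (F' := fun z φ => (fderiv ℝ (Function.uncurry F) (z, φ)).comp (ContinuousLinearMap.inl ℝ E ℝ))
    hF.continuous hF' ?_) ?_
  · intro z φ
    exact HasFDerivAt.comp (g := Function.uncurry F) (f := fun e => (e, φ)) z
      ((hF.differentiable one_ne_zero (z, φ)).hasFDerivAt) (hasFDerivAt_prodMk_left z φ)
  · have h1 := continuous_primitive_of_continuous hF'
    have h2 : Continuous fun w : E × ℝ => ContinuousLinearMap.toSpanSingleton ℝ (F w.1 w.2) :=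
      (ContinuousLinearMap.toSpanSingletonCLE (𝕜 := ℝ) (E := G)).continuous.comp hF.continuous
    exact (ContinuousLinearMap.coprodEquivL (𝕜 := ℝ) (E := E) (F := ℝ) (G := G) ℝ).continuous.comp
      (h1.prodMk h2)

/-- A parametric primitive of `G (z, κ φ)` is `C²` if `G` is `C²`, even if `κ` is only `C¹`. -/
theorem contDiff_two_primitive {g : E × H → G} (hg : ContDiff ℝ 2 g) {κ : ℝ → H}
    (hκ : ContDiff ℝ 1 κ) :
    ContDiff ℝ 2 (fun w : E × ℝ => ∫ φ in (0 : ℝ)..w.2, g (w.1, κ φ)) := by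
  have hpair : ContDiff ℝ 1 (fun w : E × ℝ => (w.1, κ w.2)) :=
    contDiff_fst.prodMk (hκ.comp contDiff_snd)
  have hF : ContDiff ℝ 1 (Function.uncurry fun z φ => g (z, κ φ)) :=
    (hg.of_le one_le_two).comp hpair
  -- `κ` is never differentiated twice: the parameter block is the primitive of this `C¹` integrand,
  -- and the end-point block is `g (z, κ θ)` itself.
  have hF' : ContDiff ℝ 1 (Function.uncurry fun z φ =>
      (fderiv ℝ g (z, κ φ)).comp (ContinuousLinearMap.inl ℝ E H)) :=
    ((hg.fderiv_right (m := 1) (by norm_num [one_add_one_eq_two])).comp hpair).clm_comp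
      contDiff_const
  refine contDiff_two_of_hasFDerivAt (hasFDerivAt_primitive_of_continuous
    (F := fun z φ => g (z, κ φ))
    (F' := fun z φ => (fderiv ℝ g (z, κ φ)).comp (ContinuousLinearMap.inl ℝ E H))
    hF.continuous hF'.continuous ?_) ?_
  · intro z φ
    exact HasFDerivAt.comp (g := g) z
      ((hg.differentiable two_ne_zero (z, κ φ)).hasFDerivAt) (hasFDerivAt_prodMk_left z (κ φ))
  · have h1 := contDiff_one_primitive hF'
    have h2 : ContDiff ℝ 1 fun w : E × ℝ =>
        ContinuousLinearMap.toSpanSingleton ℝ (g (w.1, κ w.2)) :=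
      (ContinuousLinearMap.toSpanSingletonCLE (𝕜 := ℝ) (E := G)).contDiff.comp hF
    exact (ContinuousLinearMap.coprodEquivL (𝕜 := ℝ) (E := E) (F := ℝ) (G := G) ℝ).contDiff.comp
      (h1.prodMk h2)

end ParametricIntegral

/-- A function that inverts a `C^n` map with invertible derivative is `C^n`. -/
theorem contDiffAt_of_leftInverse {V F : Type*} [NormedAddCommGroup V] [NormedSpace ℝ V]
    [NormedAddCommGroup F] [NormedSpace ℝ F] [CompleteSpace V] {n : WithTop ℕ∞} {f : V → F}
    {f' : V ≃L[ℝ] F}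
    {a : V} {g : F → V} (hf : ContDiffAt ℝ n f a) (hf' : HasFDerivAt f (f' : V →L[ℝ] F) a)
    (hn : n ≠ 0) (hg : ∀ᶠ x in 𝓝 a, g (f x) = x) : ContDiffAt ℝ n g (f a) := by
  have h := hf.to_localInverse hf' hn
  have hs : HasStrictFDerivAt f (f' : V →L[ℝ] F) a := hf.hasStrictFDerivAt' hf' hn
  refine h.congr_of_eventuallyEq ?_
  have hc : Filter.Tendsto (hs.localInverse f f' a) (𝓝 (f a)) (𝓝 a) := by
    have := hs.localInverse_continuousAt.tendsto
    rwa [hs.localInverse_apply_image] at this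
  filter_upwards [hs.eventually_right_inverse, hc.eventually hg] with y hy1 hy2
  rw [hy1] at hy2
  exact hy2

/-! ### Angular weights of a power nonlinearity -/

/-- The difference quotient of `v ↦ v ^ m` with base point `1` is `C¹`. -/
theorem contDiff_dslope_rpow {m : ℝ} (hm : 1 ≤ m) :
    ContDiff ℝ 1 (dslope (fun v : ℝ => v ^ m) 1) := by
  rw [contDiff_iff_contDiffAt]
  intro v
  by_cases hv : v = 1
  · subst hv
    -- At the base point the quotient is given by the shifted power series; elsewhere it is an
    -- honest quotient, and `m ≥ 1` makes it `C¹` also at `v = 0`.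
    have h : AnalyticAt ℝ (fun v : ℝ => v ^ m) 1 :=
      (Real.contDiffAt_rpow_const_of_ne one_ne_zero).analyticAt
    obtain ⟨s, hs⟩ := h
    exact AnalyticAt.contDiffAt ⟨_, hs.has_fpower_series_dslope_fslope⟩
  · have h : ContDiffAt ℝ 1 (fun v : ℝ => (v - 1)⁻¹ * (v ^ m - 1)) v := by
      refine ContDiffAt.mul (ContDiffAt.inv (contDiffAt_id.sub contDiffAt_const)
        (sub_ne_zero.2 hv)) (ContDiffAt.sub ?_ contDiffAt_const)
      exact (Real.contDiff_rpow_const_of_le (n := 1) (by simpa using hm)).contDiffAt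
    refine h.congr_of_eventuallyEq ?_
    filter_upwards [isOpen_ne.mem_nhds hv] with w hw
    rw [dslope_of_ne _ hw, slope_def_field]
    simp [div_eq_inv_mul]

theorem dslope_rpow_pos {m : ℝ} (hm : 1 ≤ m) {v : ℝ} (hv : 0 ≤ v) :
    0 < dslope (fun v : ℝ => v ^ m) 1 v := by
  by_cases h : v = 1
  · subst h
    rw [dslope_same, Real.deriv_rpow_const]
    simp; linarith
  · rw [dslope_of_ne _ h, slope_def_field]
    rcases lt_or_gt_of_ne h with h | h
    · have := Real.rpow_lt_rpow hv h (by linarith : 0 < m)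
      exact div_pos_of_neg_of_neg (by linarith) (by linarith)
    · have := Real.rpow_lt_rpow zero_le_one h (by linarith : 0 < m)
      exact div_pos (by linarith) (by linarith)

/-- The angular weight `j` of the power `|w|^(p-1) w`, normalized by
`j² cos² = 2 (1 - |sin|^(p+1)) / (p+1)`. -/
def angularWeight (p φ : ℝ) : ℝ :=
  √(2 / (p + 1) * dslope (fun v : ℝ => v ^ ((p + 1) / 2)) 1 (Real.sin φ ^ 2))

section AngularWeight

variable {p : ℝ} (hp : 1 < p)
include hp

theorem angularWeight_arg_pos (φ : ℝ) :
    0 < 2 / (p + 1) * dslope (fun v : ℝ => v ^ ((p + 1) / 2)) 1 (Real.sin φ ^ 2) :=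
  mul_pos (by positivity) (dslope_rpow_pos (by linarith) (sq_nonneg _))

theorem angularWeight_pos (φ : ℝ) : 0 < angularWeight p φ :=
  Real.sqrt_pos.2 (angularWeight_arg_pos hp φ)

theorem contDiff_angularWeight : ContDiff ℝ 1 (angularWeight p) := by
  refine ContDiff.sqrt ?_ fun φ => (angularWeight_arg_pos hp φ).ne'
  exact contDiff_const.mul ((contDiff_dslope_rpow (by linarith)).comp (Real.contDiff_sin.pow 2))

omit hp in
theorem angularWeight_periodic : Function.Periodic (angularWeight p) (2 * Real.pi) := by
  intro φ
  simp [angularWeight]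

/-- At `v = sin² φ` the denominator `v - 1` of the difference quotient is `-cos² φ`. In the energy
balance for `w = R sin θ` this lets `cos² θ` factor out of `w'²`, so the angular speed stays
positive at the turning points. -/
theorem angularWeight_sq_mul_cos_sq (φ : ℝ) :
    angularWeight p φ ^ 2 * Real.cos φ ^ 2
      = 2 / (p + 1) * (1 - |Real.sin φ| ^ (p + 1)) := by
  rw [angularWeight, Real.sq_sqrt (angularWeight_arg_pos hp φ).le]
  have h := sub_smul_dslope (fun v : ℝ => v ^ ((p + 1) / 2)) 1 (Real.sin φ ^ 2)
  have h2 : (Real.sin φ ^ 2) ^ ((p + 1) / 2) = |Real.sin φ| ^ (p + 1) := by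
    rw [← sq_abs, ← Real.rpow_natCast, ← Real.rpow_mul (abs_nonneg _)]
    congr 1
    push_cast
    ring
  simp only [smul_eq_mul, Real.one_rpow, h2] at h
  rw [Real.cos_sq']
  linear_combination (-2 / (p + 1)) * h

/-- Differentiate the preceding identity and cancel `2 cos φ`. Both sides are continuous and the
zeros of the cosine have dense complement, so the cancellation extends to all `φ`. -/
theorem angularWeight_deriv (φ : ℝ) :
    angularWeight p φ * deriv (angularWeight p) φ * Real.cos φ
      - angularWeight p φ ^ 2 * Real.sin φ = -(|Real.sin φ| ^ (p - 1) * Real.sin φ) := by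
  have hcont : Continuous (deriv (angularWeight p)) :=
    (contDiff_angularWeight hp).continuous_deriv le_rfl
  have hj : Continuous (angularWeight p) := (contDiff_angularWeight hp).continuous
  have hdense : Dense {φ : ℝ | Real.cos φ ≠ 0} := by
    have : {φ : ℝ | Real.cos φ ≠ 0} = {φ : ℝ | Real.cos φ = 0}ᶜ := rfl
    rw [this]
    apply Set.Countable.dense_compl ℝ
    have h : {φ : ℝ | Real.cos φ = 0} = Set.range fun k : ℤ => (2 * k + 1) * Real.pi / 2 := by
      ext φ
      simp only [Set.mem_ofPred_eq, Real.cos_eq_zero_iff, Set.mem_range]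
      exact exists_congr fun k => eq_comm
    rw [h]
    exact Set.countable_range _
  have hclosed : IsClosed {φ : ℝ | angularWeight p φ * deriv (angularWeight p) φ * Real.cos φ
      - angularWeight p φ ^ 2 * Real.sin φ = -(|Real.sin φ| ^ (p - 1) * Real.sin φ)} := by
    refine isClosed_eq (by fun_prop) ?_
    have : Continuous fun φ : ℝ => |Real.sin φ| ^ (p - 1) :=
      (Real.continuous_sin.abs).rpow_const fun _ => Or.inr (by linarith)
    fun_prop
  refine (hclosed.closure_subset_iff.2 ?_) (hdense φ)
  intro φ hφ
  have hd : HasDerivAt (angularWeight p) (deriv (angularWeight p) φ) φ :=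
    ((contDiff_angularWeight hp).differentiable one_ne_zero φ).hasDerivAt
  have h1 := (hd.pow 2).mul ((Real.hasDerivAt_cos φ).pow 2)
  have h2 := (((hasDerivAt_abs_rpow (Real.sin φ) (by linarith : 1 < p + 1)).comp φ
    (Real.hasDerivAt_sin φ)).const_sub 1).const_mul (2 / (p + 1))
  have h3 := h1.unique (h2.congr_of_eventuallyEq (Filter.Eventually.of_forall fun φ =>
    angularWeight_sq_mul_cos_sq hp φ))
  have hp1 : p + 1 ≠ 0 := by linarith
  have e : p + 1 - 2 = p - 1 := by ring
  rw [e] at h3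
  have hφ' : Real.cos φ ≠ 0 := hφ
  simp only [Set.mem_ofPred_eq]
  apply mul_left_cancel₀ (mul_ne_zero two_ne_zero hφ')
  have h4 : 2 / (p + 1) * -((p + 1) * |Real.sin φ| ^ (p - 1) * Real.sin φ * Real.cos φ)
      = -(2 * |Real.sin φ| ^ (p - 1) * Real.sin φ * Real.cos φ) := by
    field_simp
  rw [h4] at h3
  simp at h3
  linear_combination h3

end AngularWeight

/-! ### The oscillator in the angular coordinate -/

/-- `√(1 + ζ² (j₁² + χ² j₂²))` with `z = (ζ, χ)` and `k = (j₁, j₂)`. -/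
def speed (z k : ℝ × ℝ) : ℝ := √(1 + z.1 ^ 2 * (k.1 ^ 2 + z.2 ^ 2 * k.2 ^ 2))

theorem speed_arg_pos (z k : ℝ × ℝ) : 0 < 1 + z.1 ^ 2 * (k.1 ^ 2 + z.2 ^ 2 * k.2 ^ 2) := by
  positivity

theorem speed_pos (z k : ℝ × ℝ) : 0 < speed z k := Real.sqrt_pos.2 (speed_arg_pos z k)

theorem speed_sq (z k : ℝ × ℝ) :
    speed z k ^ 2 = 1 + z.1 ^ 2 * (k.1 ^ 2 + z.2 ^ 2 * k.2 ^ 2) :=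
  Real.sq_sqrt (speed_arg_pos z k).le

theorem contDiff_speed {n : WithTop ℕ∞} :
    ContDiff ℝ n fun w : (ℝ × ℝ) × (ℝ × ℝ) => speed w.1 w.2 := by
  refine ContDiff.sqrt ?_ fun w => (speed_arg_pos w.1 w.2).ne'
  fun_prop

theorem contDiff_slowness {n : WithTop ℕ∞} :
    ContDiff ℝ n fun w : (ℝ × ℝ) × (ℝ × ℝ) => (speed w.1 w.2)⁻¹ :=
  contDiff_speed.inv fun w => (speed_pos w.1 w.2).ne'

/-- The pair of angular weights of the two nonlinearities. -/
def weights (p q φ : ℝ) : ℝ × ℝ := (angularWeight p φ, angularWeight q φ)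

/-- The time in which the angle of the oscillator moves from `0` to `θ`. -/
def travel (p q : ℝ) (z : ℝ × ℝ) (θ : ℝ) : ℝ :=
  ∫ φ in (0 : ℝ)..θ, (speed z (weights p q φ))⁻¹

/-- The angle of the oscillator at time `s`. -/
def phase (p q : ℝ) (z : ℝ × ℝ) (s : ℝ) : ℝ := Function.invFun (travel p q z) s

theorem weights_periodic (p q : ℝ) : Function.Periodic (weights p q) (2 * Real.pi) := fun φ => by
  simp only [weights, angularWeight_periodic φ]

section Oscillator

variable {p q : ℝ} (hp : 1 < p) (hq : 1 < q)
include hp hq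

theorem contDiff_weights : ContDiff ℝ 1 (weights p q) :=
  (contDiff_angularWeight hp).prodMk (contDiff_angularWeight hq)

theorem contDiff_travel : ContDiff ℝ 2 fun w : (ℝ × ℝ) × ℝ => travel p q w.1 w.2 :=
  contDiff_two_primitive (g := fun w : (ℝ × ℝ) × (ℝ × ℝ) => (speed w.1 w.2)⁻¹)
    contDiff_slowness (contDiff_weights hp hq)

theorem continuous_slowness_weights (z : ℝ × ℝ) :
    Continuous fun φ => (speed z (weights p q φ))⁻¹ :=
  (contDiff_slowness (n := 0)).continuous.comp
    (continuous_const.prodMk (contDiff_weights hp hq).continuous)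

theorem hasDerivAt_travel (z : ℝ × ℝ) (θ : ℝ) :
    HasDerivAt (travel p q z) (speed z (weights p q θ))⁻¹ θ :=
  intervalIntegral.integral_hasDerivAt_right
    ((continuous_slowness_weights hp hq z).intervalIntegrable _ _)
    (continuous_slowness_weights hp hq z).stronglyMeasurable.stronglyMeasurableAtFilter
    (continuous_slowness_weights hp hq z).continuousAt

theorem travel_strictMono (z : ℝ × ℝ) : StrictMono (travel p q z) :=
  strictMono_of_hasDerivAt_pos (fun θ => hasDerivAt_travel hp hq z θ)
    fun _ => inv_pos.2 (speed_pos _ _)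

omit hp hq in
theorem travel_zero (z : ℝ × ℝ) : travel p q z 0 = 0 := by simp [travel]

theorem travel_two_pi_pos (z : ℝ × ℝ) : 0 < travel p q z (2 * Real.pi) := by
  rw [← travel_zero (p := p) (q := q) z]
  exact travel_strictMono hp hq z Real.two_pi_pos

theorem travel_add_two_pi (z : ℝ × ℝ) (θ : ℝ) :
    travel p q z (θ + 2 * Real.pi) = travel p q z θ + travel p q z (2 * Real.pi) := by
  have hc := continuous_slowness_weights hp hq z
  have hper : Function.Periodic (fun φ => (speed z (weights p q φ))⁻¹) (2 * Real.pi) := fun φ => by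
    simp only [weights_periodic p q φ]
  have h := hper.intervalIntegral_add_eq 0 θ
  rw [zero_add] at h
  rw [travel, travel, travel, h]
  exact (intervalIntegral.integral_add_adjacent_intervals (hc.intervalIntegrable _ _)
    (hc.intervalIntegrable _ _)).symm

/-- Each full turn adds the same positive time, so the values at multiples of `2π` bracket any `s`,
and the intermediate value theorem applies. -/
theorem travel_surjective (z : ℝ × ℝ) : Function.Surjective (travel p q z) := by
  have hc : Continuous (travel p q z) :=
    continuous_iff_continuousAt.2 fun θ => (hasDerivAt_travel hp hq z θ).continuousAt
  have hn : ∀ n : ℤ, travel p q z (n * (2 * Real.pi)) = n * travel p q z (2 * Real.pi) := by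
    intro n
    induction n using Int.induction_on with
    | zero => simp [travel_zero]
    | succ i ih =>
      push_cast at ih ⊢
      rw [add_mul, one_mul, travel_add_two_pi hp hq, ih]
      ring
    | pred i ih =>
      have := travel_add_two_pi hp hq z ((-i - 1 : ℝ) * (2 * Real.pi))
      rw [show (-i - 1 : ℝ) * (2 * Real.pi) + 2 * Real.pi = -i * (2 * Real.pi) by ring] at this
      push_cast at ih ⊢
      rw [ih] at this
      linarith
  intro s
  obtain ⟨n, hn1, hn2⟩ := (existsUnique_zsmul_near_of_pos
    (travel_two_pi_pos hp hq z) s).exists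
  rw [zsmul_eq_mul, ← hn] at hn1
  rw [zsmul_eq_mul, ← hn] at hn2
  have hle : (n : ℝ) * (2 * Real.pi) ≤ ((n + 1 : ℤ) : ℝ) * (2 * Real.pi) := by
    push_cast; nlinarith [Real.pi_pos]
  obtain ⟨θ, -, hθ⟩ := intermediate_value_Icc hle hc.continuousOn ⟨hn1, hn2.le⟩
  exact ⟨θ, hθ⟩

theorem phase_travel (z : ℝ × ℝ) (θ : ℝ) : phase p q z (travel p q z θ) = θ :=
  Function.leftInverse_invFun (travel_strictMono hp hq z).injective θ

theorem travel_phase (z : ℝ × ℝ) (s : ℝ) : travel p q z (phase p q z s) = s :=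
  Function.rightInverse_invFun (travel_surjective hp hq z) s

/-- Regularity jointly in the orbit parameter and time comes from inverting `(z, θ) ↦ (z, travel z
θ)`. Its derivative is triangular with diagonal blocks the identity and `1 / speed`, hence
invertible. -/
theorem contDiff_phase : ContDiff ℝ 2 fun w : (ℝ × ℝ) × ℝ => phase p q w.1 w.2 := by
  have hpair : ContDiff ℝ 2 fun w : (ℝ × ℝ) × ℝ => (w.1, phase p q w.1 w.2) := by
    rw [contDiff_iff_contDiffAt]
    rintro ⟨z, s⟩
    have hT := contDiff_travel hp hq
    set θ := phase p q z s with hθ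
    set c := (speed z (weights p q θ))⁻¹ with hcdef
    have hc : c ≠ 0 := (inv_pos.2 (speed_pos _ _)).ne'
    set L := fderiv ℝ (fun w : (ℝ × ℝ) × ℝ => travel p q w.1 w.2) (z, θ) with hL
    have hLd : HasFDerivAt (fun w : (ℝ × ℝ) × ℝ => travel p q w.1 w.2) L (z, θ) :=
      (hT.differentiable two_ne_zero (z, θ)).hasFDerivAt
    have hL1 : L (0, 1) = c := by
      have h1 : HasDerivAt (fun θ : ℝ => travel p q z θ) (L (0, 1)) θ :=
        hLd.comp_hasDerivAt (f := fun θ : ℝ => (z, θ)) θ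
          ((hasDerivAt_const θ z).prodMk (hasDerivAt_id θ))
      exact h1.unique (hasDerivAt_travel hp hq z θ)
    let e : ((ℝ × ℝ) × ℝ) ≃L[ℝ] ((ℝ × ℝ) × ℝ) :=
      (ContinuousLinearEquiv.refl ℝ (ℝ × ℝ)).skewProd
        (ContinuousLinearEquiv.unitsEquivAut ℝ (Units.mk0 c hc))
        (L.comp (ContinuousLinearMap.inl ℝ (ℝ × ℝ) ℝ))
    have hfd : HasFDerivAt (fun w : (ℝ × ℝ) × ℝ => (w.1, travel p q w.1 w.2))
        (e : ((ℝ × ℝ) × ℝ) →L[ℝ] ((ℝ × ℝ) × ℝ)) (z, θ) := by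
      refine (hasFDerivAt_fst.prodMk hLd).congr_fderiv ?_
      refine ContinuousLinearMap.ext fun v => ?_
      have hv : L v = L (v.1, 0) + v.2 * L (0, 1) := by
        rw [← smul_eq_mul, ← map_smul, ← map_add]
        simp
      have h2 : e v = (v.1, v.2 * c + L (v.1, 0)) := by
        simp [e, ContinuousLinearEquiv.skewProd_apply]
      rw [ContinuousLinearEquiv.coe_coe, h2]
      simp only [ContinuousLinearMap.prod_apply, ContinuousLinearMap.coe_fst', hv, hL1]
      rw [add_comm]
    have key := contDiffAt_of_leftInverse (n := 2)
      (g := fun w : (ℝ × ℝ) × ℝ => (w.1, phase p q w.1 w.2))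
      (contDiff_fst.prodMk hT).contDiffAt hfd two_ne_zero
      (Filter.Eventually.of_forall fun w => by simp [phase_travel hp hq])
    simp only [hθ, travel_phase hp hq] at key
    exact key
  exact contDiff_snd.comp hpair

theorem continuous_phase (z : ℝ × ℝ) : Continuous (phase p q z) :=
  (contDiff_phase hp hq).continuous.comp (Continuous.prodMk_right z)

theorem hasDerivAt_phase (z : ℝ × ℝ) (s : ℝ) :
    HasDerivAt (phase p q z) (speed z (weights p q (phase p q z s))) s := by
  have h := (hasDerivAt_travel hp hq z (phase p q z s)).of_local_left_inverse
    (continuous_phase hp hq z).continuousAt (inv_pos.2 (speed_pos _ _)).ne'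
    (Filter.Eventually.of_forall fun s => travel_phase hp hq z s)
  rwa [inv_inv] at h

theorem phase_add_period (z : ℝ × ℝ) (s : ℝ) :
    phase p q z (s + travel p q z (2 * Real.pi)) = phase p q z s + 2 * Real.pi := by
  apply (travel_strictMono hp hq z).injective
  rw [travel_phase hp hq, travel_add_two_pi hp hq, travel_phase hp hq]

end Oscillator

/-! ### The orbit of given amplitude -/

/-- The parameters `(R^((p-1)/2), R^((q-p)/2))` of the orbit of amplitude `R`. -/
def powers (p q R : ℝ) : ℝ × ℝ := (R ^ ((p - 1) / 2), R ^ ((q - p) / 2))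

/-- The solution of `w'' + w + |w|^(p-1) w + |w|^(q-1) w = 0` with amplitude `R` and `w(0) = 0`. -/
def wave (p q R s : ℝ) : ℝ := R * Real.sin (phase p q (powers p q R) s)

theorem abs_wave_le {p q R : ℝ} (hR : 0 ≤ R) (s : ℝ) : |wave p q R s| ≤ R := by
  rw [wave, abs_mul, abs_of_nonneg hR]
  exact mul_le_of_le_one_right hR (Real.abs_sin_le_one _)

theorem powers_fst_sq {p q R : ℝ} (hR : 0 ≤ R) : (powers p q R).1 ^ 2 = R ^ (p - 1) := by
  rw [powers, ← Real.rpow_natCast, ← Real.rpow_mul hR]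
  congr 1
  push_cast
  ring

theorem powers_snd_sq {p q R : ℝ} (hR : 0 ≤ R) : (powers p q R).2 ^ 2 = R ^ (q - p) := by
  rw [powers, ← Real.rpow_natCast, ← Real.rpow_mul hR]
  congr 1
  push_cast
  ring

theorem powers_mul_sq {p q R : ℝ} (hR : 0 < R) :
    (powers p q R).1 ^ 2 * (powers p q R).2 ^ 2 = R ^ (q - 1) := by
  rw [powers_fst_sq hR.le, powers_snd_sq hR.le, ← Real.rpow_add hR]
  congr 1
  ring

section Wave

variable {p q : ℝ} (hp : 1 < p) (hq : 1 < q)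
include hp hq

theorem hasDerivAt_wave (R s : ℝ) :
    HasDerivAt (wave p q R) (R * (Real.cos (phase p q (powers p q R) s)
      * speed (powers p q R) (weights p q (phase p q (powers p q R) s)))) s :=
  ((Real.hasDerivAt_sin _).comp s (hasDerivAt_phase hp hq (powers p q R) s)).const_mul R

theorem hasDerivAt_speed_weights (z : ℝ × ℝ) (θ : ℝ) :
    HasDerivAt (fun θ => speed z (weights p q θ))
      (z.1 ^ 2 * (angularWeight p θ * deriv (angularWeight p) θ
        + z.2 ^ 2 * (angularWeight q θ * deriv (angularWeight q) θ)) / speed z (weights p q θ))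
      θ := by
  have h1 : HasDerivAt (angularWeight p) (deriv (angularWeight p) θ) θ :=
    ((contDiff_angularWeight hp).differentiable one_ne_zero θ).hasDerivAt
  have h2 : HasDerivAt (angularWeight q) (deriv (angularWeight q) θ) θ :=
    ((contDiff_angularWeight hq).differentiable one_ne_zero θ).hasDerivAt
  have h := ((((h1.pow 2).add ((h2.pow 2).const_mul (z.2 ^ 2))).const_mul (z.1 ^ 2)).const_add
    1).sqrt (speed_arg_pos z (weights p q θ)).ne'
  refine h.congr_deriv ?_
  have e : √(1 + z.1 ^ 2 * (angularWeight p θ ^ 2 + z.2 ^ 2 * angularWeight q θ ^ 2))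
    = speed z (weights p q θ) := rfl
  simp only [Pi.add_apply, Pi.pow_apply, e]
  have := (speed_pos z (weights p q θ)).ne'
  field_simp
  ring

/-- With `S` the speed, the derivative is `R (-S² sin θ + cos θ · S dS/dθ)`. Expanding `S²` leaves
`-R sin θ` and one expression per nonlinearity, each of which `angularWeight_deriv` evaluates. -/
theorem hasDerivAt_wave_deriv {R : ℝ} (hR : 0 < R) (s : ℝ) :
    HasDerivAt (fun s => R * (Real.cos (phase p q (powers p q R) s)
      * speed (powers p q R) (weights p q (phase p q (powers p q R) s))))
      (-(wave p q R s + |wave p q R s| ^ (p - 1) * wave p q R s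
        + |wave p q R s| ^ (q - 1) * wave p q R s)) s := by
  set z := powers p q R with hz
  set θ := phase p q z s with hθ
  have hph := hasDerivAt_phase hp hq z s
  have h := (((Real.hasDerivAt_cos θ).comp s hph).mul
    ((hasDerivAt_speed_weights hp hq z θ).comp s hph)).const_mul R
  refine h.congr_deriv ?_
  have hS := (speed_pos z (weights p q θ)).ne'
  have hsq := speed_sq z (weights p q θ)
  have hp' := angularWeight_deriv hp θ
  have hq' := angularWeight_deriv hq θ
  have hw : wave p q R s = R * Real.sin θ := rfl
  have e1 : |R * Real.sin θ| ^ (p - 1) = z.1 ^ 2 * |Real.sin θ| ^ (p - 1) := by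
    rw [abs_mul, abs_of_pos hR, Real.mul_rpow hR.le (abs_nonneg _), hz, powers_fst_sq hR.le]
  have e2 : |R * Real.sin θ| ^ (q - 1) = z.1 ^ 2 * z.2 ^ 2 * |Real.sin θ| ^ (q - 1) := by
    rw [abs_mul, abs_of_pos hR, Real.mul_rpow hR.le (abs_nonneg _), hz, powers_mul_sq hR]
  rw [hw, e1, e2]
  simp only [Function.comp_apply, ← hθ]
  have hdiv : ∀ a : ℝ, a / speed z (weights p q θ) * speed z (weights p q θ) = a :=
    fun a => div_mul_cancel₀ a hS
  rw [hdiv]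
  simp only [weights] at hsq ⊢
  linear_combination (-R * Real.sin θ) * hsq + R * z.1 ^ 2 * hp' + R * z.1 ^ 2 * z.2 ^ 2 * hq'

theorem wave_add_period (R s : ℝ) :
    wave p q R (s + travel p q (powers p q R) (2 * Real.pi)) = wave p q R s := by
  rw [wave, wave, phase_add_period hp hq, Real.sin_add_two_pi]

theorem exists_wave_eq (R : ℝ) {a : ℝ} (ha : a ∈ Set.Icc (-1 : ℝ) 1) :
    ∃ s, wave p q R s = R * a :=
  ⟨travel p q (powers p q R) (Real.arcsin a), by
    rw [wave, phase_travel hp hq, Real.sin_arcsin ha.1 ha.2]⟩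

end Wave

/-! ### The period function -/

/-- The period of the orbit of amplitude `R`. -/
def period (p q R : ℝ) : ℝ := travel p q (powers p q R) (2 * Real.pi)

/-- Density of `(2π - period) / R^(p-1)`. -/
def defectDensity (w : (ℝ × ℝ) × (ℝ × ℝ)) : ℝ :=
  (w.2.1 ^ 2 + w.1.2 ^ 2 * w.2.2 ^ 2) / (speed w.1 w.2 * (1 + speed w.1 w.2))

/-- `(2π - period) / R^(p-1)` as a function of `powers p q R`. -/
def defect (p q : ℝ) (z : ℝ × ℝ) : ℝ :=
  ∫ φ in (0 : ℝ)..(2 * Real.pi), defectDensity (z, weights p q φ)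

/-- Density of `-R^(2-p) period'`. -/
def rateDensity (p q : ℝ) (w : (ℝ × ℝ) × (ℝ × ℝ)) : ℝ :=
  ((p - 1) * w.2.1 ^ 2 + (q - 1) * (w.1.2 ^ 2 * w.2.2 ^ 2)) / (2 * speed w.1 w.2 ^ 3)

/-- `-R^(2-p) period'` as a function of `powers p q R`. -/
def rate (p q : ℝ) (z : ℝ × ℝ) : ℝ :=
  ∫ φ in (0 : ℝ)..(2 * Real.pi), rateDensity p q (z, weights p q φ)

theorem contDiff_defectDensity : ContDiff ℝ 2 defectDensity := by
  have := contDiff_speed (n := 2)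
  refine ContDiff.div (by fun_prop) (by fun_prop) fun w => ?_
  have := speed_pos w.1 w.2
  positivity

theorem contDiff_rateDensity (p q : ℝ) : ContDiff ℝ 2 (rateDensity p q) := by
  have := contDiff_speed (n := 2)
  refine ContDiff.div (by fun_prop) (by fun_prop) fun w => ?_
  have := speed_pos w.1 w.2
  positivity

theorem hasDerivAt_powers {p q R : ℝ} (hR : 0 < R) :
    HasDerivAt (powers p q) ((p - 1) / 2 * (powers p q R).1 / R,
      (q - p) / 2 * (powers p q R).2 / R) R := by
  have h : ∀ a : ℝ, HasDerivAt (fun R : ℝ => R ^ a) (a * R ^ a / R) R := fun a => by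
    refine (Real.hasDerivAt_rpow_const (Or.inl hR.ne')).congr_deriv ?_
    rw [Real.rpow_sub_one hR.ne', mul_div_assoc]
  exact (h _).prodMk (h _)

section Period

variable {p q : ℝ} (hp : 1 < p) (hpq : p < q)
include hp hpq

theorem continuous_powers : Continuous (powers p q) :=
  (Real.continuous_rpow_const (by linarith)).prodMk (Real.continuous_rpow_const (by linarith))

theorem powers_zero : powers p q 0 = 0 := by
  rw [powers, Real.zero_rpow (by linarith), Real.zero_rpow (by linarith)]
  rfl

theorem contDiff_integral_weights {g : (ℝ × ℝ) × (ℝ × ℝ) → ℝ} (hg : ContDiff ℝ 2 g) :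
    ContDiff ℝ 2 fun z : ℝ × ℝ => ∫ φ in (0 : ℝ)..(2 * Real.pi), g (z, weights p q φ) :=
  (contDiff_two_primitive hg (contDiff_weights hp (hp.trans hpq))).comp
    (contDiff_id.prodMk (contDiff_const (c := 2 * Real.pi)))

theorem contDiff_defect : ContDiff ℝ 2 (defect p q) :=
  contDiff_integral_weights hp hpq contDiff_defectDensity

theorem contDiff_rate : ContDiff ℝ 2 (rate p q) :=
  contDiff_integral_weights hp hpq (contDiff_rateDensity p q)

theorem continuous_comp_weights {g : (ℝ × ℝ) × (ℝ × ℝ) → ℝ} (hg : ContDiff ℝ 2 g) (z : ℝ × ℝ) :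
    Continuous fun φ => g (z, weights p q φ) :=
  hg.continuous.comp (continuous_const.prodMk (contDiff_weights hp (hp.trans hpq)).continuous)

theorem defect_pos (z : ℝ × ℝ) : 0 < defect p q z := by
  refine intervalIntegral.intervalIntegral_pos_of_pos
    ((continuous_comp_weights hp hpq contDiff_defectDensity z).intervalIntegrable _ _)
    (fun φ => ?_) Real.two_pi_pos
  have h1 := speed_pos z (weights p q φ)
  have h2 : 0 < (weights p q φ).1 := angularWeight_pos hp φ
  simp only [defectDensity]
  positivity

theorem rate_pos (z : ℝ × ℝ) : 0 < rate p q z := by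
  refine intervalIntegral.intervalIntegral_pos_of_pos
    ((continuous_comp_weights hp hpq (contDiff_rateDensity p q) z).intervalIntegrable _ _)
    (fun φ => ?_) Real.two_pi_pos
  have h1 := speed_pos z (weights p q φ)
  have h2 : 0 < (weights p q φ).1 := angularWeight_pos hp φ
  have h3 : 0 < p - 1 := by linarith
  have h4 : 0 < q - 1 := by linarith
  simp only [rateDensity]
  positivity

/-- Pointwise `1 - 1/S = (S² - 1) / (S (1 + S))`, and `S² - 1` carries the factor `R^(p-1)`. The
remaining factor is positive and `C²` in the powers of `R`, also at `R = 0`. -/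
theorem two_pi_sub_period {R : ℝ} (hR : 0 ≤ R) :
    2 * Real.pi - period p q R = R ^ (p - 1) * defect p q (powers p q R) := by
  set z := powers p q R with hz
  have h : ∀ φ, 1 - (speed z (weights p q φ))⁻¹
      = R ^ (p - 1) * defectDensity (z, weights p q φ) := by
    intro φ
    have h1 := speed_pos z (weights p q φ)
    have h2 := speed_sq z (weights p q φ)
    rw [← powers_fst_sq (q := q) hR, ← hz, defectDensity]
    have h3 : (1 + speed z (weights p q φ)) ≠ 0 := by positivity
    field_simp
    linear_combination h2
  have hc := continuous_slowness_weights hp (hp.trans hpq) z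
  rw [defect, ← intervalIntegral.integral_const_mul]
  simp only [← h]
  rw [intervalIntegral.integral_sub intervalIntegrable_const (hc.intervalIntegrable _ _)]
  simp [period, travel, ← hz]

theorem period_zero : period p q 0 = 2 * Real.pi := by
  have := two_pi_sub_period hp hpq le_rfl
  rw [Real.zero_rpow (by linarith), zero_mul] at this
  linarith

theorem continuous_period : Continuous (period p q) :=
  (contDiff_travel hp (hp.trans hpq)).continuous.comp
    ((continuous_powers hp hpq).prodMk (continuous_const (y := 2 * Real.pi)))

theorem contDiffAt_period {R : ℝ} (hR : 0 < R) : ContDiffAt ℝ 2 (period p q) R := by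
  have h : ContDiffAt ℝ 2 (powers p q) R :=
    (Real.contDiffAt_rpow_const_of_ne hR.ne').prodMk (Real.contDiffAt_rpow_const_of_ne hR.ne')
  exact (contDiff_travel hp (hp.trans hpq)).contDiffAt.comp R
    (h.prodMk (contDiffAt_const (c := 2 * Real.pi)))

omit hp hpq in
theorem hasDerivAt_slowness_powers {R : ℝ} (hR : 0 < R) (k : ℝ × ℝ) :
    HasDerivAt (fun R => (speed (powers p q R) k)⁻¹)
      (-(R ^ (p - 1) / R * rateDensity p q (powers p q R, k))) R := by
  set z := powers p q R with hz
  have hP := hasDerivAt_powers (p := p) (q := q) hR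
  rw [← hz] at hP
  have h1 : HasDerivAt (fun R => (powers p q R).1) ((p - 1) / 2 * z.1 / R) R :=
    hP.fst
  have h2 : HasDerivAt (fun R => (powers p q R).2) ((q - p) / 2 * z.2 / R) R :=
    hP.snd
  have h := (((((h1.pow 2).mul (((h2.pow 2).mul_const (k.2 ^ 2)).const_add (k.1 ^ 2))).const_add
    1).sqrt (speed_arg_pos z k).ne').inv (speed_pos z k).ne')
  refine h.congr_deriv ?_
  have e : √(1 + z.1 ^ 2 * (k.1 ^ 2 + z.2 ^ 2 * k.2 ^ 2)) = speed z k := rfl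
  simp only [Pi.mul_apply, Pi.pow_apply, ← hz, e]
  rw [← powers_fst_sq (q := q) hR.le, ← hz, rateDensity]
  have := (speed_pos z k).ne'
  field_simp
  ring

/-- Differentiate `1/S` under the integral through the powers of `R`. Splitting off `R^(p-1) / R`
isolates the only part that is singular or degenerate at `R = 0`. -/
theorem hasDerivAt_period {R : ℝ} (hR : 0 < R) :
    HasDerivAt (period p q) (-(R ^ (p - 1) / R * rate p q (powers p q R))) R := by
  set z := powers p q R with hz
  have hw := (contDiff_weights hp (hp.trans hpq)).continuous
  have hF' : Continuous (Function.uncurry fun (z : ℝ × ℝ) φ =>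
      (fderiv ℝ (fun w : (ℝ × ℝ) × (ℝ × ℝ) => (speed w.1 w.2)⁻¹) (z, weights p q φ)).comp
        (ContinuousLinearMap.inl ℝ (ℝ × ℝ) (ℝ × ℝ))) :=
    (((contDiff_slowness (n := 1)).continuous_fderiv one_ne_zero).comp
      (continuous_fst.prodMk (hw.comp continuous_snd))).clm_comp continuous_const
  have hslow : ∀ w : (ℝ × ℝ) × (ℝ × ℝ),
      HasFDerivAt (fun w : (ℝ × ℝ) × (ℝ × ℝ) => (speed w.1 w.2)⁻¹)
        (fderiv ℝ (fun w : (ℝ × ℝ) × (ℝ × ℝ) => (speed w.1 w.2)⁻¹) w) w := fun w =>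
    ((contDiff_slowness (n := 1)).differentiable one_ne_zero w).hasFDerivAt
  have hI := hasFDerivAt_integral_of_continuous
    (F := fun z φ => (speed z (weights p q φ))⁻¹)
    (F' := fun z φ =>
      (fderiv ℝ (fun w : (ℝ × ℝ) × (ℝ × ℝ) => (speed w.1 w.2)⁻¹) (z, weights p q φ)).comp
        (ContinuousLinearMap.inl ℝ (ℝ × ℝ) (ℝ × ℝ)))
    ((contDiff_slowness (n := 0)).continuous.comp
      (continuous_fst.prodMk (hw.comp continuous_snd))) hF'
    (fun z φ => HasFDerivAt.comp (g := fun w : (ℝ × ℝ) × (ℝ × ℝ) => (speed w.1 w.2)⁻¹)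
      (f := fun z => (z, weights p q φ)) z (hslow (z, weights p q φ))
      (hasFDerivAt_prodMk_left z (weights p q φ)))
    0 (2 * Real.pi) z
  have hP := hasDerivAt_powers (p := p) (q := q) hR
  have h := hI.comp_hasDerivAt R hP
  refine h.congr_deriv ?_
  refine (ContinuousLinearMap.intervalIntegral_apply
    ((hF'.comp (Continuous.prodMk_right z)).intervalIntegrable _ _) _).trans ?_
  rw [rate, ← intervalIntegral.integral_const_mul, ← intervalIntegral.integral_neg]
  refine intervalIntegral.integral_congr fun φ _ => ?_
  have h1 := HasFDerivAt.comp_hasDerivAt R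
    (HasFDerivAt.comp (g := fun w : (ℝ × ℝ) × (ℝ × ℝ) => (speed w.1 w.2)⁻¹)
      (f := fun z => (z, weights p q φ)) z (hslow (z, weights p q φ))
      (hasFDerivAt_prodMk_left z (weights p q φ))) hP
  exact h1.unique (hasDerivAt_slowness_powers hR (weights p q φ))

theorem period_strictAntiOn : StrictAntiOn (period p q) (Set.Ici 0) := by
  refine strictAntiOn_of_deriv_neg (convex_Ici 0) (continuous_period hp hpq).continuousOn ?_
  intro R hR
  rw [interior_Ici, Set.mem_Ioi] at hR
  rw [(hasDerivAt_period hp hpq hR).deriv, neg_lt_zero]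
  have := rate_pos hp hpq (powers p q R)
  have := Real.rpow_pos_of_pos hR (p - 1)
  positivity

theorem period_pos (R : ℝ) : 0 < period p q R := travel_two_pi_pos hp (hp.trans hpq) _

/-- Keeping only the `p`-term under the root gives `S ≥ R^((p-1)/2) j_p`, so the period is
`O(R^(-(p-1)/2))`. -/
theorem tendsto_period_atTop : Filter.Tendsto (period p q) Filter.atTop (𝓝 0) := by
  have hj : Continuous fun φ => (angularWeight p φ)⁻¹ :=
    (contDiff_angularWeight hp).continuous.inv₀ fun φ => (angularWeight_pos hp φ).ne'
  set C := ∫ φ in (0 : ℝ)..(2 * Real.pi), (angularWeight p φ)⁻¹ with hC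
  have hlim : Filter.Tendsto (fun R : ℝ => R ^ (-((p - 1) / 2)) * C) Filter.atTop (𝓝 0) := by
    simpa using (tendsto_rpow_neg_atTop (by linarith : 0 < (p - 1) / 2)).mul_const C
  refine tendsto_of_tendsto_of_tendsto_of_le_of_le' tendsto_const_nhds hlim
    (Filter.Eventually.of_forall fun R => (period_pos hp hpq R).le) ?_
  filter_upwards [Filter.eventually_gt_atTop 0] with R hR
  rw [hC, ← intervalIntegral.integral_const_mul, period, travel]
  refine intervalIntegral.integral_mono_on Real.two_pi_pos.le
    ((continuous_slowness_weights hp (hp.trans hpq) _).intervalIntegrable _ _)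
    ((continuous_const.mul hj).intervalIntegrable _ _) fun φ _ => ?_
  rw [Real.rpow_neg hR.le, ← mul_inv]
  have hζ : 0 < R ^ ((p - 1) / 2) := Real.rpow_pos_of_pos hR _
  have hjp := angularWeight_pos hp φ
  refine inv_anti₀ (mul_pos hζ hjp) ?_
  refine Real.le_sqrt_of_sq_le ?_
  simp only [powers, weights]
  have : 0 ≤ (R ^ ((p - 1) / 2)) ^ 2 * ((R ^ ((q - p) / 2)) ^ 2 * angularWeight q φ ^ 2) := by
    positivity
  nlinarith

theorem exists_period_eq {v : ℝ} (hv : 0 < v) (hv1 : v ≤ 1) :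
    ∃ R ∈ Set.Ici (0 : ℝ), period p q R = 2 * Real.pi * v := by
  have hpos : 0 < 2 * Real.pi * v := mul_pos Real.two_pi_pos hv
  obtain ⟨R₁, hR₁, hR₁'⟩ := (((tendsto_period_atTop hp hpq).eventually
    (gt_mem_nhds hpos)).and (Filter.eventually_ge_atTop 0)).exists
  obtain ⟨R, hR, hR'⟩ := intermediate_value_Icc' hR₁' (continuous_period hp hpq).continuousOn
    (show 2 * Real.pi * v ∈ Set.Icc (period p q R₁) (period p q 0) from
      ⟨hR₁.le, by rw [period_zero hp hpq]; nlinarith [Real.two_pi_pos]⟩)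
  exact ⟨R, hR.1, hR'⟩

end Period

/-! ### The amplitude as a function of the period -/

/-- The amplitude of the orbit of period `2 π v`. -/
def amplitude (p q v : ℝ) : ℝ := Function.invFunOn (period p q) (Set.Ici 0) (2 * Real.pi * v)

section Amplitude

variable {p q : ℝ} (hp : 1 < p) (hpq : p < q)
include hp hpq

theorem amplitude_nonneg {v : ℝ} (hv : 0 < v) (hv1 : v ≤ 1) : 0 ≤ amplitude p q v :=
  Function.invFunOn_mem (exists_period_eq hp hpq hv hv1)

theorem period_amplitude {v : ℝ} (hv : 0 < v) (hv1 : v ≤ 1) :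
    period p q (amplitude p q v) = 2 * Real.pi * v :=
  Function.invFunOn_eq (exists_period_eq hp hpq hv hv1)

theorem period_le {R : ℝ} (hR : 0 ≤ R) : period p q R ≤ 2 * Real.pi := by
  rw [← period_zero hp hpq]
  exact (period_strictAntiOn hp hpq).antitoneOn Set.self_mem_Ici hR hR

theorem amplitude_period {R : ℝ} (hR : 0 ≤ R) :
    amplitude p q (period p q R / (2 * Real.pi)) = R := by
  have h0 : 0 < period p q R / (2 * Real.pi) :=
    div_pos (period_pos hp hpq R) Real.two_pi_pos
  have h1 : period p q R / (2 * Real.pi) ≤ 1 :=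
    (div_le_one Real.two_pi_pos).2 (period_le hp hpq hR)
  refine (period_strictAntiOn hp hpq).injOn (amplitude_nonneg hp hpq h0 h1) hR ?_
  rw [period_amplitude hp hpq h0 h1]
  exact mul_div_cancel₀ _ Real.two_pi_pos.ne'

theorem amplitude_one : amplitude p q 1 = 0 := by
  have := amplitude_period hp hpq (le_refl 0)
  rwa [period_zero hp hpq, div_self Real.two_pi_pos.ne'] at this

theorem amplitude_lt_iff {v R : ℝ} (hv : 0 < v) (hv1 : v ≤ 1) (hR : 0 ≤ R) :
    amplitude p q v < R ↔ period p q R < 2 * Real.pi * v := by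
  rw [← period_amplitude hp hpq hv hv1]
  exact ((period_strictAntiOn hp hpq).lt_iff_gt hR (amplitude_nonneg hp hpq hv hv1)).symm

theorem amplitude_pos {v : ℝ} (hv : 0 < v) (hv1 : v < 1) : 0 < amplitude p q v := by
  refine lt_of_le_of_ne (amplitude_nonneg hp hpq hv hv1.le) fun h => ?_
  have := period_amplitude hp hpq hv hv1.le
  rw [← h, period_zero hp hpq] at this
  nlinarith [Real.two_pi_pos]

/-- This is the quantitative link between `1 - σ` and the amplitude; both the flatness at the origin
and the decay at infinity rest on it. -/
theorem one_sub_eq_amplitude {v : ℝ} (hv : 0 < v) (hv1 : v ≤ 1) :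
    2 * Real.pi * (1 - v) = amplitude p q v ^ (p - 1) * defect p q (powers p q (amplitude p q v))
      := by
  rw [← two_pi_sub_period hp hpq (amplitude_nonneg hp hpq hv hv1),
    period_amplitude hp hpq hv hv1]
  ring

/-- For `R > 0` the derivative of the period is nonzero, so the inverse is as smooth as the period.
The value `v = 1` is excluded: there `R = 0`, and the derivative, of order `R^(p-2)`, may vanish or
blow up. -/
theorem contDiffAt_amplitude {v : ℝ} (hv : 0 < v) (hv1 : v < 1) :
    ContDiffAt ℝ 2 (amplitude p q) v := by
  set R := amplitude p q v with hR
  have hRpos : 0 < R := amplitude_pos hp hpq hv hv1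
  have hrate := rate_pos hp hpq (powers p q R)
  have hpow := Real.rpow_pos_of_pos hRpos (p - 1)
  have hd := (hasDerivAt_period hp hpq hRpos).div_const (2 * Real.pi)
  have hc : -(R ^ (p - 1) / R * rate p q (powers p q R)) / (2 * Real.pi) ≠ 0 := by
    have := Real.pi_pos
    apply ne_of_lt
    rw [neg_div, neg_lt_zero]
    positivity
  have key := contDiffAt_of_leftInverse (n := 2) (f := fun R => period p q R / (2 * Real.pi))
    (g := amplitude p q) (a := R)
    (f' := ContinuousLinearEquiv.unitsEquivAut ℝ (Units.mk0 _ hc))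
    ((contDiffAt_period hp hpq hRpos).div_const _)
    (hd.hasFDerivAt.congr_fderiv (by ext; simp)) two_ne_zero ?_
  · rwa [hR, period_amplitude hp hpq hv hv1.le,
      mul_div_cancel_left₀ _ Real.two_pi_pos.ne'] at key
  · filter_upwards [lt_mem_nhds hRpos] with S hS
    exact amplitude_period hp hpq hS.le

theorem hasDerivAt_amplitude {v : ℝ} (hv : 0 < v) (hv1 : v < 1) :
    HasDerivAt (amplitude p q) (-(2 * Real.pi) / (amplitude p q v ^ (p - 1) / amplitude p q v
      * rate p q (powers p q (amplitude p q v)))) v := by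
  set R := amplitude p q v with hR
  have hRpos : 0 < R := amplitude_pos hp hpq hv hv1
  have hrate := rate_pos hp hpq (powers p q R)
  have hpow := Real.rpow_pos_of_pos hRpos (p - 1)
  have hd : HasDerivAt (amplitude p q) (deriv (amplitude p q) v) v :=
    ((contDiffAt_amplitude hp hpq hv hv1).differentiableAt two_ne_zero).hasDerivAt
  have h1 := (hasDerivAt_period hp hpq hRpos).comp v hd
  have h2 : HasDerivAt (fun v => 2 * Real.pi * v) (2 * Real.pi * 1) v :=
    (hasDerivAt_id v).const_mul _
  have h3 := h1.unique (h2.congr_of_eventuallyEq (by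
    filter_upwards [lt_mem_nhds hv, gt_mem_nhds hv1] with w hw hw1
    exact period_amplitude hp hpq hw hw1.le))
  refine hd.congr_deriv ?_
  rw [eq_div_iff (by positivity)]
  linarith

end Amplitude

/-! ### Functions flat along the kernel of a projection -/

section Flat

variable {V F : Type*} [NormedAddCommGroup V] [NormedSpace ℝ V]
  [NormedAddCommGroup F] [NormedSpace ℝ F]

/-- A `C¹` function that vanishes together with its derivative on the kernel of `π`. -/
structure Flat (π : V →L[ℝ] V) (f : V → F) : Prop where
  contDiff : ContDiff ℝ 1 f
  eq_zero : ∀ z, π z = 0 → f z = 0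
  fderiv_eq_zero : ∀ z, π z = 0 → fderiv ℝ f z = 0

/-- A `C²` function that vanishes together with its first two derivatives on the kernel of `π`. -/
structure Flat₂ (π : V →L[ℝ] V) (f : V → F) : Prop where
  flat : Flat π f
  flat_fderiv : Flat π (fderiv ℝ f)

variable {π : V →L[ℝ] V} {f : V → F}

theorem Flat₂.contDiff (hf : Flat₂ π f) : ContDiff ℝ 2 f :=
  contDiff_two_of_hasFDerivAt
    (fun z => (hf.flat.contDiff.differentiable one_ne_zero z).hasFDerivAt) hf.flat_fderiv.contDiff

/-- A property that holds near a point `z₀` of the kernel holds on the segments from points near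
`z₀` to their projections. -/
theorem eventually_forall_segment {P : V → Prop} {z₀ : V} (hz₀ : π z₀ = 0)
    (hP : ∀ᶠ z in 𝓝 z₀, P z) : ∀ᶠ z in 𝓝 z₀, ∀ w ∈ segment ℝ z (z - π z), P w := by
  obtain ⟨δ, hδ, hball⟩ := Metric.eventually_nhds_iff_ball.1 hP
  have hc : Filter.Tendsto (fun z => z - π z) (𝓝 z₀) (𝓝 z₀) := by
    have : ContinuousAt (fun z => z - π z) z₀ := by fun_prop
    simpa [ContinuousAt, hz₀] using this
  filter_upwards [Metric.ball_mem_nhds z₀ hδ, hc.eventually (Metric.ball_mem_nhds z₀ hδ)]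
    with z h1 h2 w hw
  exact hball w ((convex_ball z₀ δ).segment_subset h1 h2 hw)

section Projection

variable (hπ : ∀ z, π (π z) = π z)
include hπ

/-- The mean value inequality on the segment from `z` to its projection `z - π z` onto the kernel,
where `f` vanishes, gives `‖f z‖ ≤ ε ‖π z‖` near the kernel. Hence the derivative exists and is zero
there, and the assumed limit makes it continuous. -/
theorem flat_of_tendsto (h0 : ∀ z, π z = 0 → f z = 0)
    (h1 : ∀ z, π z ≠ 0 → ContDiffAt ℝ 1 f z)
    (h2 : ∀ z₀, π z₀ = 0 → Filter.Tendsto f (𝓝[{z | π z ≠ 0}] z₀) (𝓝 0))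
    (h3 : ∀ z₀, π z₀ = 0 → Filter.Tendsto (fderiv ℝ f) (𝓝[{z | π z ≠ 0}] z₀) (𝓝 0)) :
    Flat π f := by
  have hcont : Continuous f := by
    rw [continuous_iff_continuousAt]
    intro z
    by_cases hz : π z = 0
    · rw [ContinuousAt, h0 z hz, Metric.tendsto_nhds]
      intro ε hε
      have := eventually_nhdsWithin_iff.1 ((Metric.tendsto_nhds.1 (h2 z hz)) ε hε)
      filter_upwards [this] with w hw
      by_cases hw0 : π w = 0
      · simpa [h0 w hw0] using hε
      · exact hw hw0
    · exact (h1 z hz).continuousAt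
  have hder : ∀ z₀, π z₀ = 0 → HasFDerivAt f (0 : V →L[ℝ] F) z₀ := by
    intro z₀ hz₀
    rw [hasFDerivAt_iff_isLittleO, Asymptotics.isLittleO_iff]
    intro c hc
    -- Chosen to absorb `‖π z‖ ≤ ‖π‖ ‖z - z₀‖`; the added `1` keeps the denominator positive.
    set ε := c / (‖π‖ + 1) with hε
    have hεpos : 0 < ε := by positivity
    have hev := eventually_forall_segment (π := π) hz₀
      (eventually_nhdsWithin_iff.1 ((Metric.tendsto_nhds.1 (h3 z₀ hz₀)) ε hεpos))
    filter_upwards [hev] with z hz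
    have key : ‖f z‖ ≤ ε * ‖π z‖ := by
      by_cases hz0 : π z = 0
      · simp [h0 z hz0, hz0]
      -- Only the end point `s = 1` lies in the kernel, so `f` is differentiable along `[0, 1)`,
      -- which is all the one-sided mean value inequality requires.
      have hproj : ∀ s : ℝ, π (z - s • π z) = (1 - s) • π z := fun s => by
        rw [map_sub, map_smul, hπ, sub_smul, one_smul]
      have hpath : ∀ s : ℝ, HasDerivAt (fun s : ℝ => z - s • π z) (-π z) s := fun s => by
        simpa using ((hasDerivAt_id s).smul_const (π z)).const_sub z
      have hmem : ∀ s ∈ Set.Icc (0 : ℝ) 1, z - s • π z ∈ segment ℝ z (z - π z) := fun s hs => by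
        rw [segment_eq_image']
        exact ⟨s, hs, by simp [sub_eq_add_neg]⟩
      have hmv := norm_image_sub_le_of_norm_deriv_right_le_segment
        (f := fun s : ℝ => f (z - s • π z)) (f' := fun s => fderiv ℝ f (z - s • π z) (-π z))
        (a := 0) (b := 1) (C := ε * ‖π z‖)
        (hcont.comp (by fun_prop)).continuousOn
        (fun s hs => by
          have hne : π (z - s • π z) ≠ 0 := by
            rw [hproj]
            exact smul_ne_zero (by linarith [hs.2]) hz0
          exact (((h1 _ hne).differentiableAt one_ne_zero).hasFDerivAt.comp_hasDerivAt s
            (hpath s)).hasDerivWithinAt)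
        (fun s hs => by
          have hne : π (z - s • π z) ≠ 0 := by
            rw [hproj]
            exact smul_ne_zero (by linarith [hs.2]) hz0
          have hb := hz _ (hmem s ⟨hs.1, hs.2.le⟩) hne
          rw [dist_zero_right] at hb
          refine (ContinuousLinearMap.le_opNorm _ _).trans ?_
          rw [norm_neg]
          exact mul_le_mul_of_nonneg_right hb.le (norm_nonneg _))
        1 ⟨zero_le_one, le_rfl⟩
      have hend : f (z - π z) = 0 := h0 _ (by rw [map_sub, hπ, sub_self])
      simpa [hend] using hmv
    have hbound : ‖π z‖ ≤ ‖π‖ * ‖z - z₀‖ := by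
      have := π.le_opNorm (z - z₀)
      rwa [map_sub, hz₀, sub_zero] at this
    rw [h0 z₀ hz₀]
    simp only [sub_zero, zero_apply]
    calc ‖f z‖ ≤ ε * (‖π‖ * ‖z - z₀‖) := key.trans (mul_le_mul_of_nonneg_left hbound hεpos.le)
      _ ≤ ε * ((‖π‖ + 1) * ‖z - z₀‖) := by gcongr; linarith
      _ = c * ‖z - z₀‖ := by
        rw [hε]
        field_simp
  have hfd : ∀ z₀, π z₀ = 0 → fderiv ℝ f z₀ = 0 := fun z₀ hz₀ => (hder z₀ hz₀).fderiv
  refine ⟨?_, h0, hfd⟩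
  rw [contDiff_one_iff_fderiv]
  constructor
  · intro z
    by_cases hz : π z = 0
    · exact (hder z hz).differentiableAt
    · exact (h1 z hz).differentiableAt one_ne_zero
  · rw [continuous_iff_continuousAt]
    intro z
    by_cases hz : π z = 0
    · rw [ContinuousAt, hfd z hz, Metric.tendsto_nhds]
      intro ε hε
      have := eventually_nhdsWithin_iff.1 ((Metric.tendsto_nhds.1 (h3 z hz)) ε hε)
      filter_upwards [this] with w hw
      by_cases hw0 : π w = 0
      · simpa [hfd w hw0] using hε
      · exact hw hw0
    · exact (h1 z hz).continuousAt_fderiv one_ne_zero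

theorem flat₂_of_tendsto (h0 : ∀ z, π z = 0 → f z = 0)
    (h1 : ∀ z, π z ≠ 0 → ContDiffAt ℝ 2 f z)
    (h2 : ∀ z₀, π z₀ = 0 → Filter.Tendsto f (𝓝[{z | π z ≠ 0}] z₀) (𝓝 0))
    (h3 : ∀ z₀, π z₀ = 0 → Filter.Tendsto (fderiv ℝ f) (𝓝[{z | π z ≠ 0}] z₀) (𝓝 0))
    (h4 : ∀ z₀, π z₀ = 0 →
      Filter.Tendsto (fderiv ℝ (fderiv ℝ f)) (𝓝[{z | π z ≠ 0}] z₀) (𝓝 0)) :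
    Flat₂ π f := by
  have hf := flat_of_tendsto hπ h0 (fun z hz => (h1 z hz).of_le one_le_two) h2 h3
  exact ⟨hf, flat_of_tendsto hπ hf.fderiv_eq_zero
    (fun z hz => (h1 z hz).fderiv_right (by norm_num [one_add_one_eq_two])) h3 h4⟩

theorem norm_le_of_segment (hf : Differentiable ℝ f) (h0 : ∀ z, π z = 0 → f z = 0) {z : V} {C : ℝ}
    (hC : ∀ w ∈ segment ℝ z (z - π z), ‖fderiv ℝ f w‖ ≤ C) : ‖f z‖ ≤ C * ‖π z‖ := by
  have h := (convex_segment z (z - π z)).norm_image_sub_le_of_norm_fderiv_le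
    (fun w _ => hf w) hC (right_mem_segment ℝ _ _) (left_mem_segment ℝ _ _)
  have hend : f (z - π z) = 0 := h0 _ (by rw [map_sub, hπ, sub_self])
  simpa [hend] using h

theorem Flat.eventually_norm_le (hf : Flat π f) {z₀ : V} (hz₀ : π z₀ = 0) {ε : ℝ} (hε : 0 < ε) :
    ∀ᶠ z in 𝓝 z₀, ‖f z‖ ≤ ε * ‖π z‖ := by
  have hc := (hf.contDiff.continuous_fderiv one_ne_zero).continuousAt (x := z₀)
  rw [ContinuousAt, hf.fderiv_eq_zero z₀ hz₀] at hc
  filter_upwards [eventually_forall_segment hz₀ (Metric.tendsto_nhds.1 hc ε hε)] with z hz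
  refine norm_le_of_segment hπ (hf.contDiff.differentiable one_ne_zero) hf.eq_zero fun w hw => ?_
  simpa using (hz w hw).le

/-- The first-order bound for the derivative is integrated along the segment to the kernel, on which
`‖π w‖ ≤ ‖π z‖`. The resulting `o(‖π z‖²)` is what pays for divisions by `|x|` later. -/
theorem Flat₂.eventually_norm_le (hf : Flat₂ π f) {z₀ : V} (hz₀ : π z₀ = 0) {ε : ℝ}
    (hε : 0 < ε) : ∀ᶠ z in 𝓝 z₀, ‖f z‖ ≤ ε * ‖π z‖ ^ 2 := by
  filter_upwards [eventually_forall_segment hz₀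
    (hf.flat_fderiv.eventually_norm_le hπ hz₀ hε)] with z hz
  have : ‖f z‖ ≤ ε * ‖π z‖ * ‖π z‖ := by
    refine norm_le_of_segment hπ (hf.flat.contDiff.differentiable one_ne_zero) hf.flat.eq_zero
      fun w hw => (hz w hw).trans (mul_le_mul_of_nonneg_left ?_ hε.le)
    rw [segment_eq_image'] at hw
    obtain ⟨s, hs, rfl⟩ := hw
    have : π (z + s • (z - π z - z)) = (1 - s) • π z := by
      rw [sub_sub_cancel_left, smul_neg, ← sub_eq_add_neg, map_sub, map_smul, hπ, sub_smul,
        one_smul]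
    rw [this, norm_smul, Real.norm_of_nonneg (by linarith [hs.2])]
    exact mul_le_of_le_one_left (norm_nonneg _) (by linarith [hs.1])
  rwa [sq, ← mul_assoc]

end Projection

theorem Flat.tendsto_zero (hf : Flat π f) {z₀ : V} (hz₀ : π z₀ = 0) :
    Filter.Tendsto f (𝓝 z₀) (𝓝 0) := by
  have := hf.contDiff.continuous.tendsto z₀
  rwa [hf.eq_zero z₀ hz₀] at this

theorem Flat.tendsto_fderiv_zero (hf : Flat π f) {z₀ : V} (hz₀ : π z₀ = 0) :
    Filter.Tendsto (fderiv ℝ f) (𝓝 z₀) (𝓝 0) := by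
  have := (hf.contDiff.continuous_fderiv one_ne_zero).tendsto z₀
  rwa [hf.fderiv_eq_zero z₀ hz₀] at this

theorem Flat.add {g : V → F} (hf : Flat π f) (hg : Flat π g) : Flat π (fun z => f z + g z) := by
  refine ⟨hf.contDiff.add hg.contDiff, fun z hz => by simp [hf.eq_zero z hz, hg.eq_zero z hz],
    fun z hz => ?_⟩
  rw [fderiv_fun_add (hf.contDiff.differentiable one_ne_zero z)
    (hg.contDiff.differentiable one_ne_zero z), hf.fderiv_eq_zero z hz, hg.fderiv_eq_zero z hz,
    add_zero]

/-- Each term of the product rule contains `f` or its derivative. The closure properties for the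
various products are instances of this one. -/
theorem Flat.bilinear {A G : Type*} [NormedAddCommGroup A] [NormedSpace ℝ A]
    [NormedAddCommGroup G] [NormedSpace ℝ G] (B : A →L[ℝ] F →L[ℝ] G) {a : V → A}
    (ha : ContDiff ℝ 1 a) (hf : Flat π f) : Flat π (fun z => B (a z) (f z)) := by
  refine ⟨(B.isBoundedBilinearMap.contDiff).comp (ha.prodMk hf.contDiff),
    fun z hz => by simp [hf.eq_zero z hz], fun z hz => ?_⟩
  rw [B.fderiv_of_bilinear (ha.differentiable one_ne_zero z)
    (hf.contDiff.differentiable one_ne_zero z), hf.fderiv_eq_zero z hz, hf.eq_zero z hz]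
  ext v
  simp

theorem Flat.clm_comp {G : Type*} [NormedAddCommGroup G] [NormedSpace ℝ G] (L : F →L[ℝ] G)
    (hf : Flat π f) : Flat π (fun z => L (f z)) :=
  Flat.bilinear (ContinuousLinearMap.id ℝ (F →L[ℝ] G)) (contDiff_const (c := L)) hf

theorem Flat.smul {a : V → ℝ} (ha : ContDiff ℝ 1 a) (hf : Flat π f) :
    Flat π (fun z => a z • f z) :=
  Flat.bilinear (ContinuousLinearMap.lsmul ℝ ℝ) ha hf

theorem Flat.smulRight {E : Type*} [NormedAddCommGroup E] [NormedSpace ℝ E] {a : V → E →L[ℝ] ℝ}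
    (ha : ContDiff ℝ 1 a) (hf : Flat π f) : Flat π (fun z => (a z).smulRight (f z)) :=
  Flat.bilinear (ContinuousLinearMap.smulRightL ℝ E F) ha hf

theorem Flat₂.smul {a : V → ℝ} (ha : ContDiff ℝ 2 a) (hf : Flat₂ π f) :
    Flat₂ π (fun z => a z • f z) := by
  refine ⟨hf.flat.smul (ha.of_le one_le_two), ?_⟩
  have : fderiv ℝ (fun z => a z • f z)
      = fun z => a z • fderiv ℝ f z + (fderiv ℝ a z).smulRight (f z) := by
    ext1 z
    exact fderiv_fun_smul (ha.differentiable two_ne_zero z)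
      (hf.flat.contDiff.differentiable one_ne_zero z)
  rw [this]
  exact (hf.flat_fderiv.smul (ha.of_le one_le_two)).add
    (hf.flat.smulRight (ha.fderiv_right (by norm_num [one_add_one_eq_two])))

/-- A nonnegative function that is flat to second order satisfies `|∇f|² ≤ ε f` near `0`. -/
theorem eventually_sq_norm_fderiv_le {f : V → ℝ} (hf : Flat₂ (ContinuousLinearMap.id ℝ V) f)
    (hnn : ∀ z, 0 ≤ f z) {ε : ℝ} (hε : 0 < ε) :
    ∀ᶠ z in 𝓝 (0 : V), ‖fderiv ℝ f z‖ ^ 2 ≤ ε * f z := by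
  set η := ε / 4 with hη
  have hηpos : 0 < η := by positivity
  obtain ⟨δ, hδ, hball⟩ := Metric.eventually_nhds_iff_ball.1
    (Metric.tendsto_nhds.1 (hf.flat_fderiv.tendsto_fderiv_zero (z₀ := 0) rfl) η hηpos)
  have hlip : ∀ x ∈ Metric.ball (0 : V) δ, ∀ y ∈ Metric.ball (0 : V) δ,
      ‖fderiv ℝ f y - fderiv ℝ f x‖ ≤ η * ‖y - x‖ := fun x hx y hy =>
    (convex_ball (0 : V) δ).norm_image_sub_le_of_norm_fderiv_le
      (fun w _ => hf.flat_fderiv.contDiff.differentiable one_ne_zero w)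
      (fun w hw => by simpa using (hball w hw).le) hx hy
  filter_upwards [Metric.ball_mem_nhds (0 : V) (half_pos hδ)] with z hz
  rw [mem_ball_zero_iff] at hz
  have h0 : fderiv ℝ f 0 = 0 := hf.flat.fderiv_eq_zero 0 rfl
  have hzb : z ∈ Metric.ball (0 : V) δ := by rw [mem_ball_zero_iff]; linarith
  have hDz : ‖fderiv ℝ f z‖ ≤ η * ‖z‖ := by
    simpa [h0] using hlip 0 (Metric.mem_ball_self hδ) z hzb
  have key : ∀ v : V, ‖v‖ = 1 → (fderiv ℝ f z v) ^ 2 ≤ ε * f z := by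
    intro v hv
    set a := fderiv ℝ f z v with ha
    have haz : |a| ≤ η * ‖z‖ := by
      have := (fderiv ℝ f z).le_opNorm v
      rw [hv, mul_one] at this
      exact this.trans hDz
    -- This step minimizes the upper bound `f z + Df(z) h + η ‖h‖²` for `f (z + h)` along the line
    -- of `v`. As `f (z + h) ≥ 0`, the minimum yields `a² ≤ 4 η f z = ε f z`. The bound `‖h‖ ≤ ‖z‖ /
    -- 2` keeps `z + h` in the ball.
    set h := -(a / (2 * η)) • v with hh
    have hnorm : ‖h‖ = |a| / (2 * η) := by
      rw [hh, norm_smul, hv, mul_one, Real.norm_eq_abs, abs_neg, abs_div,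
        abs_of_pos (by positivity : 0 < 2 * η)]
    have hhz : ‖h‖ ≤ ‖z‖ / 2 := by
      rw [hnorm, div_le_iff₀ (by positivity)]
      linarith
    have hzh : z + h ∈ Metric.ball (0 : V) δ := by
      rw [mem_ball_zero_iff]
      have := norm_add_le z h
      linarith
    have hmv := (convex_segment z (z + h)).norm_image_sub_le_of_norm_fderiv_le'
      (f := f) (φ := fderiv ℝ f z) (C := η * ‖h‖)
      (fun w _ => hf.flat.contDiff.differentiable one_ne_zero w)
      (fun w hw => by
        refine (hlip z hzb w ((convex_ball (0 : V) δ).segment_subset hzb hzh hw)).trans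
          (mul_le_mul_of_nonneg_left ?_ hηpos.le)
        rw [segment_eq_image'] at hw
        obtain ⟨s, hs, rfl⟩ := hw
        rw [add_sub_cancel_left, add_sub_cancel_left, norm_smul, Real.norm_of_nonneg hs.1]
        exact mul_le_of_le_one_left (norm_nonneg _) hs.2)
      (left_mem_segment ℝ _ _) (right_mem_segment ℝ _ _)
    rw [add_sub_cancel_left] at hmv
    have h1 := (abs_le.1 (by simpa using hmv)).2
    have h2 := hnn (z + h)
    have h3 : fderiv ℝ f z h = -(a ^ 2 / (2 * η)) := by
      rw [hh, map_smul, ← ha, smul_eq_mul]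
      ring
    have h4 : η * ‖h‖ * ‖h‖ = a ^ 2 / (4 * η) := by
      rw [hnorm]
      have := sq_abs a
      field_simp
      linarith
    have h5 : a ^ 2 / (2 * η) = 2 * (a ^ 2 / (4 * η)) := by ring
    have h6 : a ^ 2 / (4 * η) ≤ f z := by
      rw [h3, h4] at h1
      linarith
    rw [div_le_iff₀ (by positivity), hη] at h6
    linarith
  have hle : ‖fderiv ℝ f z‖ ≤ √(ε * f z) :=
    ContinuousLinearMap.opNorm_le_of_unit_norm (Real.sqrt_nonneg _) fun v hv =>
      Real.abs_le_sqrt (key v hv)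
  calc ‖fderiv ℝ f z‖ ^ 2 ≤ √(ε * f z) ^ 2 := by gcongr
    _ = ε * f z := Real.sq_sqrt (mul_nonneg hε.le (hnn z))

end Flat

/-! ### Flatness and fractional powers of the amplitude -/

section Powers

variable {V F : Type*} [NormedAddCommGroup V] [NormedSpace ℝ V]
  [NormedAddCommGroup F] [NormedSpace ℝ F] {π : V →L[ℝ] V} {p q : ℝ}

/-- The logarithmic derivative `R d/dR` of `powers p q R`, as a function of `powers p q R`. -/
def powersRate (p q : ℝ) (z : ℝ × ℝ) : ℝ × ℝ := ((p - 1) / 2 * z.1, (q - p) / 2 * z.2)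

theorem contDiff_powersRate {n : WithTop ℕ∞} : ContDiff ℝ n (powersRate p q) := by
  unfold powersRate
  fun_prop

theorem hasDerivAt_powers' {R : ℝ} (hR : 0 < R) :
    HasDerivAt (powers p q) (R⁻¹ • powersRate p q (powers p q R)) R := by
  refine (hasDerivAt_powers hR).congr_deriv ?_
  ext <;> simp [powersRate, div_eq_inv_mul]

theorem contDiffAt_powers {n : WithTop ℕ∞} {R : ℝ} (hR : 0 < R) :
    ContDiffAt ℝ n (powers p q) R :=
  (Real.contDiffAt_rpow_const_of_ne hR.ne').prodMk (Real.contDiffAt_rpow_const_of_ne hR.ne')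

theorem hasFDerivAt_comp_powers {G : Type*} [NormedAddCommGroup G] [NormedSpace ℝ G]
    {H : (ℝ × ℝ) × ℝ → G} (hH : ContDiff ℝ 1 H) {R s : V → ℝ} {z : V}
    (hR : DifferentiableAt ℝ R z) (hs : DifferentiableAt ℝ s z) (hpos : 0 < R z) :
    HasFDerivAt (fun z => H (powers p q (R z), s z))
      ((fderiv ℝ R z).smulRight ((R z)⁻¹ • fderiv ℝ H (powers p q (R z), s z)
          (powersRate p q (powers p q (R z)), 0))
        + (fderiv ℝ s z).smulRight (fderiv ℝ H (powers p q (R z), s z) (0, 1))) z := by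
  have h1 : HasFDerivAt (fun z => powers p q (R z))
      ((fderiv ℝ R z).smulRight ((R z)⁻¹ • powersRate p q (powers p q (R z)))) z := by
    have := (hasDerivAt_powers' (p := p) (q := q) hpos).hasFDerivAt.comp z hR.hasFDerivAt
    refine this.congr_fderiv ?_
    ext v <;> simp
  have h2 := ((hH.differentiable one_ne_zero (powers p q (R z), s z)).hasFDerivAt).comp z
    (f := fun z => (powers p q (R z), s z)) (h1.prodMk hs.hasFDerivAt)
  refine h2.congr_fderiv ?_
  ext v
  set L := fderiv ℝ H (powers p q (R z), s z)
  simp only [ContinuousLinearMap.comp_apply, ContinuousLinearMap.prod_apply,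
    ContinuousLinearMap.smulRight_apply, add_apply]
  rw [← map_smul, ← map_smul, ← map_smul, ← map_add]
  congr 1
  ext <;> simp

section Coefficients

variable (hπ : ∀ z, π (π z) = π z) (hp : 1 < p) (hpq : p < q)
include hπ hp hpq

/-- Multiplying a flat function by a `C¹` function of `(powers p q R, s)` keeps it flat, although
`powers p q R` is not differentiable where `R = 0`. -/
theorem Flat.smul_powers {R s : V → ℝ} (hR : ContDiff ℝ 1 R) (hR0 : ∀ z, π z = 0 → R z = 0)
    (hRpos : ∀ z, π z ≠ 0 → 0 < R z) (hs : ContDiff ℝ 1 s) {H : (ℝ × ℝ) × ℝ → ℝ}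
    (hH : ContDiff ℝ 1 H) {X : V → F} (hX : Flat π X)
    (hXR : ∀ z₀, π z₀ = 0 → ∃ C : ℝ, ∀ᶠ z in 𝓝 z₀, ‖X z‖ * ‖fderiv ℝ R z‖ ≤ C * R z) :
    Flat π (fun z => H (powers p q (R z), s z) • X z) := by
  have hΓ : Continuous fun z => (powers p q (R z), s z) :=
    ((continuous_powers hp hpq).comp hR.continuous).prodMk hs.continuous
  have hHc : Continuous fun z => H (powers p q (R z), s z) := hH.continuous.comp hΓ
  have hDHc : Continuous fun z => fderiv ℝ H (powers p q (R z), s z) :=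
    (hH.continuous_fderiv one_ne_zero).comp hΓ
  have hRd := hR.differentiable one_ne_zero
  have hsd := hs.differentiable one_ne_zero
  refine flat_of_tendsto hπ (fun z hz => by simp [hX.eq_zero z hz]) ?_ ?_ ?_
  · intro z hz
    refine ContDiffAt.smul (hH.contDiffAt.comp z (ContDiffAt.prodMk ?_ hs.contDiffAt))
      hX.contDiff.contDiffAt
    exact (contDiffAt_powers (hRpos z hz)).comp z hR.contDiffAt
  · intro z₀ hz₀
    have := (hHc.tendsto z₀).smul (hX.tendsto_zero hz₀)
    rw [smul_zero] at this
    exact this.mono_left nhdsWithin_le_nhds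
  · intro z₀ hz₀
    obtain ⟨C, hC⟩ := hXR z₀ hz₀
    have hb : Continuous fun z => powersRate p q (powers p q (R z)) :=
      (contDiff_powersRate (n := 0)).continuous.comp
        ((continuous_powers hp hpq).comp hR.continuous)
    -- The dangerous term has size `R⁻¹ ‖∇R‖ ‖X‖`, at most `C` by `hXR`, times the derivative of `H`
    -- in the direction `powersRate`. That direction tends to `0` with `R`, so boundedness of the
    -- first factor suffices.
    have hlim : Filter.Tendsto (fun z => |H (powers p q (R z), s z)| * ‖fderiv ℝ X z‖
        + (C * ‖fderiv ℝ H (powers p q (R z), s z) (powersRate p q (powers p q (R z)), 0)‖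
          + ‖fderiv ℝ s z‖ * ‖fderiv ℝ H (powers p q (R z), s z) (0, 1)‖ * ‖X z‖))
        (𝓝 z₀) (𝓝 0) := by
      have hc : Continuous (fun z => |H (powers p q (R z), s z)| * ‖fderiv ℝ X z‖
        + (C * ‖fderiv ℝ H (powers p q (R z), s z) (powersRate p q (powers p q (R z)), 0)‖
          + ‖fderiv ℝ s z‖ * ‖fderiv ℝ H (powers p q (R z), s z) (0, 1)‖ * ‖X z‖)) := by
        have h1 := hX.contDiff.continuous_fderiv one_ne_zero
        have h2 := hs.continuous_fderiv one_ne_zero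
        have h3 := hX.contDiff.continuous
        have h4 : Continuous fun z => fderiv ℝ H (powers p q (R z), s z)
            (powersRate p q (powers p q (R z)), 0) :=
          hDHc.clm_apply (hb.prodMk continuous_const)
        have h5 : Continuous fun z => fderiv ℝ H (powers p q (R z), s z) (0, 1) :=
          hDHc.clm_apply continuous_const
        fun_prop
      have := hc.tendsto z₀
      have hb0 : powersRate p q 0 = 0 := by simp [powersRate]
      simp only [hX.eq_zero z₀ hz₀, hX.fderiv_eq_zero z₀ hz₀, hR0 z₀ hz₀,
        powers_zero hp hpq, hb0, norm_zero, mul_zero, add_zero,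
        show ((0 : ℝ × ℝ), (0 : ℝ)) = 0 from rfl, map_zero] at this
      exact this
    refine squeeze_zero_norm' ?_ (hlim.mono_left nhdsWithin_le_nhds)
    filter_upwards [nhdsWithin_le_nhds hC, self_mem_nhdsWithin] with z hz hz0
    have hpos : 0 < R z := hRpos z hz0
    have hd := hasFDerivAt_comp_powers (p := p) (q := q) hH (hRd z) (hsd z) hpos
    have hfd := (hd.smul (hX.contDiff.differentiable one_ne_zero z).hasFDerivAt).fderiv
    rw [show (fun z => H (powers p q (R z), s z) • X z)
      = (fun z => H (powers p q (R z), s z)) • X from rfl, hfd]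
    set a := fderiv ℝ H (powers p q (R z), s z) (powersRate p q (powers p q (R z)), 0)
    set b := fderiv ℝ H (powers p q (R z), s z) (0, 1)
    refine (norm_add_le _ _).trans (add_le_add ?_ ?_)
    · rw [norm_smul, Real.norm_eq_abs]
    · rw [ContinuousLinearMap.norm_smulRight_apply]
      have hn : ‖(fderiv ℝ R z).smulRight ((R z)⁻¹ • a) + (fderiv ℝ s z).smulRight b‖
          ≤ ‖fderiv ℝ R z‖ * ((R z)⁻¹ * ‖a‖) + ‖fderiv ℝ s z‖ * ‖b‖ := by
        refine (norm_add_le _ _).trans (le_of_eq ?_)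
        rw [ContinuousLinearMap.norm_smulRight_apply, ContinuousLinearMap.norm_smulRight_apply,
          norm_smul, Real.norm_of_nonneg (inv_pos.2 hpos).le]
      calc _ ≤ (‖fderiv ℝ R z‖ * ((R z)⁻¹ * ‖a‖) + ‖fderiv ℝ s z‖ * ‖b‖) * ‖X z‖ := by gcongr
        _ = (‖X z‖ * ‖fderiv ℝ R z‖) * (R z)⁻¹ * ‖a‖ + ‖fderiv ℝ s z‖ * ‖b‖ * ‖X z‖ := by ring
        _ ≤ (C * R z) * (R z)⁻¹ * ‖a‖ + ‖fderiv ℝ s z‖ * ‖b‖ * ‖X z‖ := by gcongr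
        _ = _ := by rw [mul_inv_cancel_right₀ hpos.ne']

/-- The factor `R` cancels the `R⁻¹` produced by differentiating the powers. The derivative is
therefore a sum of `C¹` functions of `(powers R, s)` times the flat fields `∇R` and `R ∇s`, to which
`Flat.smul_powers` applies; for `∇R` this requires `|∇R|² ≤ C R`. -/
theorem Flat₂.smul_powers {R s : V → ℝ} (hR : Flat₂ π R) (hRpos : ∀ z, π z ≠ 0 → 0 < R z)
    (hRsq : ∀ z₀, π z₀ = 0 → ∃ C : ℝ, ∀ᶠ z in 𝓝 z₀, ‖fderiv ℝ R z‖ ^ 2 ≤ C * R z)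
    (hs : ContDiff ℝ 2 s) {h : (ℝ × ℝ) × ℝ → ℝ} (hh : ContDiff ℝ 2 h) :
    Flat₂ π (fun z => h (powers p q (R z), s z) • R z) := by
  have hs1 : ContDiff ℝ 1 s := hs.of_le one_le_two
  have hh1 : ContDiff ℝ 1 h := hh.of_le one_le_two
  have hDh : ContDiff ℝ 1 (fderiv ℝ h) := hh.fderiv_right (by norm_num [one_add_one_eq_two])
  have hDs : ContDiff ℝ 1 (fderiv ℝ s) := hs.fderiv_right (by norm_num [one_add_one_eq_two])
  have hRnn : ∀ z, 0 ≤ R z := fun z => by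
    by_cases hz : π z = 0
    · exact (hR.flat.eq_zero z hz).ge
    · exact (hRpos z hz).le
  have hbd : ∀ (g : V → ℝ), Continuous g → ∀ z₀, ∃ C : ℝ, ∀ᶠ z in 𝓝 z₀, g z ≤ C := fun g hg z₀ =>
    ⟨g z₀ + 1, (hg.tendsto z₀).eventually_le_const (by linarith)⟩
  have hDR : Continuous fun z => ‖fderiv ℝ R z‖ := hR.flat_fderiv.contDiff.continuous.norm
  have hf : Flat π (fun z => h (powers p q (R z), s z) • R z) := by
    refine hR.flat.smul_powers hπ hp hpq hR.flat.contDiff hR.flat.eq_zero hRpos hs1 hh1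
      fun z₀ _ => ?_
    obtain ⟨C, hC⟩ := hbd _ hDR z₀
    refine ⟨C, hC.mono fun z hz => ?_⟩
    rw [Real.norm_of_nonneg (hRnn z), mul_comm]
    exact mul_le_mul_of_nonneg_right hz (hRnn z)
  refine ⟨hf, ?_⟩
  have e : fderiv ℝ (fun z => h (powers p q (R z), s z) • R z) = fun z =>
      (fun w : (ℝ × ℝ) × ℝ => h w + fderiv ℝ h w (powersRate p q w.1, 0)) (powers p q (R z), s z)
        • fderiv ℝ R z
      + (fun w : (ℝ × ℝ) × ℝ => fderiv ℝ h w (0, 1)) (powers p q (R z), s z)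
        • (R z • fderiv ℝ s z) := by
    ext1 z
    by_cases hz : π z = 0
    · rw [hf.fderiv_eq_zero z hz]
      simp [hR.flat.eq_zero z hz, hR.flat.fderiv_eq_zero z hz]
    · have hpos := hRpos z hz
      have hd := hasFDerivAt_comp_powers (p := p) (q := q) hh1
        (hR.flat.contDiff.differentiable one_ne_zero z) (hs1.differentiable one_ne_zero z) hpos
      refine (hd.smul (hR.flat.contDiff.differentiable one_ne_zero z).hasFDerivAt).fderiv.trans ?_
      ext v
      simp
      field_simp
      ring
  rw [e]
  refine Flat.add ?_ ?_
  · refine hR.flat_fderiv.smul_powers hπ hp hpq hR.flat.contDiff hR.flat.eq_zero hRpos hs1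
      (H := fun w => h w + fderiv ℝ h w (powersRate p q w.1, 0)) ?_ fun z₀ hz₀ => ?_
    · exact hh1.add (hDh.clm_apply ((contDiff_powersRate.comp contDiff_fst).prodMk contDiff_const))
    · simpa only [sq] using hRsq z₀ hz₀
  · have hX : Flat π (fun z => R z • fderiv ℝ s z) :=
      Flat.bilinear (ContinuousLinearMap.lsmul ℝ ℝ).flip hDs hR.flat
    refine hX.smul_powers hπ hp hpq hR.flat.contDiff hR.flat.eq_zero hRpos hs1
      (H := fun w => fderiv ℝ h w (0, 1)) ?_ fun z₀ _ => ?_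
    · exact hDh.clm_apply contDiff_const
    · obtain ⟨C, hC⟩ := hbd (fun z => ‖fderiv ℝ s z‖ * ‖fderiv ℝ R z‖)
        (hDs.continuous.norm.mul hDR) z₀
      refine ⟨C, hC.mono fun z hz => ?_⟩
      rw [norm_smul, Real.norm_of_nonneg (hRnn z), mul_assoc, mul_comm]
      exact mul_le_mul_of_nonneg_right hz (hRnn z)

end Coefficients

end Powers

/-! ### Transfer of flatness from `U` to the amplitude -/

section LogarithmicDerivative

variable {V : Type*} [NormedAddCommGroup V] [NormedSpace ℝ V]

/-- If `U ≥ 0` is flat to second order at `0`, and `R` satisfies `U ∇R = B(R) ∇U` with `B(R)/U` and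
`B'(R)` bounded near `0`, then `R` is flat to second order at `0`. -/
theorem flat₂_of_smul_fderiv {U R : V → ℝ} {B B' : ℝ → ℝ}
    (hU : Flat₂ (ContinuousLinearMap.id ℝ V) U) (hUpos : ∀ z, z ≠ 0 → 0 < U z)
    (hR : ∀ z, z ≠ 0 → ContDiffAt ℝ 2 R z) (hR0 : R 0 = 0)
    (hRlim : Filter.Tendsto R (𝓝[≠] 0) (𝓝 0)) (hRpos : ∀ z, z ≠ 0 → 0 < R z)
    (hB : ∀ r, 0 < r → HasDerivAt B (B' r) r)
    (hDR : ∀ z, z ≠ 0 → fderiv ℝ R z = (B (R z) / U z) • fderiv ℝ U z)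
    {C : ℝ} (hC : ∀ᶠ z in 𝓝[≠] 0, |B (R z) / U z| ≤ C) {C' : ℝ}
    (hC' : ∀ᶠ z in 𝓝[≠] 0, |B' (R z)| ≤ C') :
    Flat₂ (ContinuousLinearMap.id ℝ V) R := by
  have hset : {z : V | (ContinuousLinearMap.id ℝ V) z ≠ 0} = {0}ᶜ := by ext z; simp
  have hUnn : ∀ z, 0 ≤ U z := fun z => by
    by_cases hz : z = 0
    · exact (hU.flat.eq_zero z hz).ge
    · exact (hUpos z hz).le
  have hDU : Filter.Tendsto (fun z => ‖fderiv ℝ U z‖) (𝓝[≠] (0 : V)) (𝓝 0) := by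
    simpa using ((hU.flat.tendsto_fderiv_zero (z₀ := 0) rfl).norm).mono_left nhdsWithin_le_nhds
  have hDDU : Filter.Tendsto (fun z => ‖fderiv ℝ (fderiv ℝ U) z‖) (𝓝[≠] (0 : V)) (𝓝 0) := by
    simpa using ((hU.flat_fderiv.tendsto_fderiv_zero (z₀ := 0) rfl).norm).mono_left
      nhdsWithin_le_nhds
  refine flat₂_of_tendsto (fun _ => rfl) (fun z hz => by rw [show z = 0 from hz, hR0]) hR ?_ ?_ ?_
  all_goals
    intro z₀ hz₀
    obtain rfl : z₀ = 0 := hz₀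
    rw [hset]
  · exact hRlim
  · refine squeeze_zero_norm' (a := fun z => C * ‖fderiv ℝ U z‖) ?_ (by simpa using hDU.const_mul C)
    filter_upwards [hC, self_mem_nhdsWithin] with z hz hz0
    rw [hDR z hz0, norm_smul]
    exact mul_le_mul_of_nonneg_right hz (norm_nonneg _)
  · refine (Metric.tendsto_nhds (α := V →L[ℝ] V →L[ℝ] ℝ)).2 fun ε hε => ?_
    -- Bounds the factor `g (B' - 1)` occurring in the second derivative; the last `1` ensures
    -- positivity.
    set K := |C| * (|C'| + 1) + 1 with hK
    have hKpos : 0 < K := by positivity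
    have hsq := nhdsWithin_le_nhds (s := {0}ᶜ)
      (eventually_sq_norm_fderiv_le hU hUnn (ε := ε / (2 * K)) (by positivity))
    have hlim2 := (by simpa using hDDU.const_mul |C| :
      Filter.Tendsto (fun z => |C| * ‖fderiv ℝ (fderiv ℝ U) z‖) (𝓝[≠] (0 : V)) (𝓝 0)).eventually
        (gt_mem_nhds (half_pos hε))
    filter_upwards [hC, hC', hsq, hlim2, self_mem_nhdsWithin] with z h1 h2 h3 h4 hz0
    have hz : z ≠ 0 := hz0
    set g := B (R z) / U z with hg
    have hUz := hUpos z hz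
    have hRd : HasFDerivAt R (g • fderiv ℝ U z) z := by
      rw [hg, ← hDR z hz]
      exact ((hR z hz).differentiableAt two_ne_zero).hasFDerivAt
    have hUd : HasFDerivAt U (fderiv ℝ U z) z :=
      (hU.flat.contDiff.differentiable one_ne_zero z).hasFDerivAt
    have hgd : HasFDerivAt (fun z => B (R z) / U z)
        ((g * (B' (R z) - 1) / U z) • fderiv ℝ U z) z := by
      have hBd := (hB (R z) (hRpos z hz)).comp_hasFDerivAt z hRd
      have hinv := (hasDerivAt_inv hUz.ne').comp_hasFDerivAt z hUd
      refine (hBd.mul hinv).congr_fderiv ?_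
      ext v
      simp [hg]
      field_simp
      ring
    have hev : fderiv ℝ R =ᶠ[𝓝 z] fun z => (B (R z) / U z) • fderiv ℝ U z := by
      filter_upwards [isOpen_ne.mem_nhds hz] with w hw using hDR w hw
    -- The first term tends to `0` because `g` is bounded. The second has size `|g (B' - 1)| ‖∇U‖² /
    -- U`, where the division by `U` is compensated by `‖∇U‖² ≤ ε U / (2 K)`.
    have hfd : fderiv ℝ (fderiv ℝ R) z = g • fderiv ℝ (fderiv ℝ U) z
        + ((g * (B' (R z) - 1) / U z) • fderiv ℝ U z).smulRight (fderiv ℝ U z) := by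
      rw [hev.fderiv_eq]
      exact (hgd.smul (hU.flat_fderiv.contDiff.differentiable one_ne_zero z).hasFDerivAt).fderiv
    suffices h : ‖fderiv ℝ (fderiv ℝ R) z‖ < ε from
      (dist_zero_right (fderiv ℝ (fderiv ℝ R) z)).trans_lt h
    rw [hfd]
    have hC0 : |g| ≤ |C| := h1.trans (le_abs_self C)
    have hB0 : |B' (R z) - 1| ≤ |C'| + 1 := by
      have := abs_sub (B' (R z)) 1
      have h2' := h2.trans (le_abs_self C')
      rw [abs_one] at this
      linarith
    refine (norm_add_le (E := V →L[ℝ] V →L[ℝ] ℝ) _ _).trans_lt ?_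
    have e1 : ‖g • fderiv ℝ (fderiv ℝ U) z‖ < ε / 2 := by
      have hle := ContinuousLinearMap.opNorm_smul_le g (fderiv ℝ (fderiv ℝ U) z)
      have hnn := ContinuousLinearMap.opNorm_nonneg (fderiv ℝ (fderiv ℝ U) z)
      exact (hle.trans (mul_le_mul_of_nonneg_right hC0 hnn)).trans_lt h4
    have e2 : ‖((g * (B' (R z) - 1) / U z) • fderiv ℝ U z).smulRight (fderiv ℝ U z)‖ ≤ ε / 2 := by
      rw [ContinuousLinearMap.norm_smulRight_apply, norm_smul, Real.norm_eq_abs, abs_div, abs_mul,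
        abs_of_pos hUz]
      calc |g| * |B' (R z) - 1| / U z * ‖fderiv ℝ U z‖ * ‖fderiv ℝ U z‖
          = |g| * |B' (R z) - 1| * (‖fderiv ℝ U z‖ ^ 2 / U z) := by ring
        _ ≤ K * (ε / (2 * K)) := by
            refine mul_le_mul ?_ ?_ (by positivity) hKpos.le
            · have := mul_le_mul hC0 hB0 (abs_nonneg _) (abs_nonneg _)
              linarith
            · rwa [div_le_iff₀ hUz]
        _ = ε / 2 := by field_simp
    linarith

end LogarithmicDerivative

/-! ### Radial fields on space-time -/

/-- The projection of `ℝ³ × ℝ` onto the space coordinates. -/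
def spaceProj : E3 × ℝ →L[ℝ] E3 × ℝ :=
  (ContinuousLinearMap.inl ℝ E3 ℝ).comp (ContinuousLinearMap.fst ℝ E3 ℝ)

theorem spaceProj_apply (z : E3 × ℝ) : spaceProj z = (z.1, 0) := rfl

theorem spaceProj_idem (z : E3 × ℝ) : spaceProj (spaceProj z) = spaceProj z := rfl

theorem spaceProj_eq_zero {z : E3 × ℝ} : spaceProj z = 0 ↔ z.1 = 0 := by
  simp [spaceProj_apply, Prod.ext_iff]

theorem norm_spaceProj (z : E3 × ℝ) : ‖spaceProj z‖ = ‖z.1‖ := by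
  simp [spaceProj_apply, Prod.norm_def]

theorem Flat.comp_fst {F : Type*} [NormedAddCommGroup F] [NormedSpace ℝ F] {f : E3 → F}
    (hf : Flat (ContinuousLinearMap.id ℝ E3) f) : Flat spaceProj fun z : E3 × ℝ => f z.1 := by
  refine ⟨hf.contDiff.comp contDiff_fst,
    fun z hz => hf.eq_zero _ (spaceProj_eq_zero.1 hz), fun z hz => ?_⟩
  have h := ((hf.contDiff.differentiable one_ne_zero z.1).hasFDerivAt).comp z
    (hasFDerivAt_fst (𝕜 := ℝ) (p := z))
  refine h.fderiv.trans ?_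
  rw [hf.fderiv_eq_zero _ (spaceProj_eq_zero.1 hz)]
  rfl

theorem fderiv_comp_fst {f : E3 → ℝ} (hf : Differentiable ℝ f) :
    fderiv ℝ (fun z : E3 × ℝ => f z.1)
      = fun z => (fderiv ℝ f z.1).comp (ContinuousLinearMap.fst ℝ E3 ℝ) := by
  ext1 z
  exact ((hf z.1).hasFDerivAt.comp z (hasFDerivAt_fst (𝕜 := ℝ) (p := z))).fderiv

theorem Flat₂.comp_fst {f : E3 → ℝ} (hf : Flat₂ (ContinuousLinearMap.id ℝ E3) f) :
    Flat₂ spaceProj fun z : E3 × ℝ => f z.1 := by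
  refine ⟨hf.flat.comp_fst, ?_⟩
  rw [fderiv_comp_fst (hf.flat.contDiff.differentiable one_ne_zero)]
  exact hf.flat_fderiv.comp_fst.clm_comp
    ((ContinuousLinearMap.compL ℝ (E3 × ℝ) E3 ℝ).flip (ContinuousLinearMap.fst ℝ E3 ℝ))

theorem norm_fderiv_comp_fst_le {f : E3 → ℝ} (hf : Differentiable ℝ f) (z : E3 × ℝ) :
    ‖fderiv ℝ (fun z : E3 × ℝ => f z.1) z‖ ≤ ‖fderiv ℝ f z.1‖ := by
  rw [fderiv_comp_fst hf]
  refine (ContinuousLinearMap.opNorm_comp_le _ _).trans ?_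
  exact mul_le_of_le_one_right (norm_nonneg _) (ContinuousLinearMap.norm_fst_le ℝ E3 ℝ)

/-- The `j`-th coordinate functional on `ℝ³`. -/
def coord (j : Fin 3) : E3 →L[ℝ] ℝ := EuclideanSpace.proj j

theorem coord_apply (j : Fin 3) (x : E3) : coord j x = x j := rfl

theorem abs_coord_le (j : Fin 3) (x : E3) : |x j| ≤ ‖x‖ := PiLp.norm_apply_le x j

theorem norm_coord_le (j : Fin 3) : ‖coord j‖ ≤ 1 :=
  ContinuousLinearMap.opNorm_le_bound _ zero_le_one fun x => by
    rw [one_mul]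
    exact abs_coord_le j x

theorem hasFDerivAt_norm {x : E3} (hx : x ≠ 0) :
    HasFDerivAt (fun x : E3 => ‖x‖) (‖x‖⁻¹ • ∑ j, x j • coord j) x := by
  have hn : ‖x‖ ≠ 0 := norm_ne_zero_iff.2 hx
  have h := (hasStrictFDerivAt_norm_sq x).hasFDerivAt.sqrt (pow_ne_zero 2 hn)
  simp only [Real.sqrt_sq (norm_nonneg _)] at h
  refine h.congr_fderiv ?_
  ext v
  have : inner ℝ x v = ∑ j, x j * v j := by
    simp [PiLp.inner_apply, mul_comm]
  simp [this, coord_apply, Fin.sum_univ_three]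
  field_simp

section UnitVector

variable {F : Type*} [NormedAddCommGroup F] [NormedSpace ℝ F]

theorem Flat.smul_of_tendsto {c : E3 × ℝ → ℝ} {f : E3 × ℝ → F} (hf : Flat spaceProj f)
    (hc : ∀ z, spaceProj z ≠ 0 → ContDiffAt ℝ 1 c z)
    (h1 : ∀ z₀, spaceProj z₀ = 0 →
      Filter.Tendsto (fun z => |c z| * ‖f z‖) (𝓝[{z | spaceProj z ≠ 0}] z₀) (𝓝 0))
    (h2 : ∀ z₀, spaceProj z₀ = 0 →
      Filter.Tendsto (fun z => |c z| * ‖fderiv ℝ f z‖) (𝓝[{z | spaceProj z ≠ 0}] z₀) (𝓝 0))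
    (h3 : ∀ z₀, spaceProj z₀ = 0 →
      Filter.Tendsto (fun z => ‖fderiv ℝ c z‖ * ‖f z‖) (𝓝[{z | spaceProj z ≠ 0}] z₀) (𝓝 0)) :
    Flat spaceProj fun z => c z • f z := by
  refine flat_of_tendsto spaceProj_idem (fun z hz => by simp [hf.eq_zero z hz])
    (fun z hz => (hc z hz).smul hf.contDiff.contDiffAt) (fun z₀ hz₀ => ?_) fun z₀ hz₀ => ?_
  · refine squeeze_zero_norm' (Filter.Eventually.of_forall fun z => ?_) (h1 z₀ hz₀)
    rw [norm_smul, Real.norm_eq_abs]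
  · have hsum := (h2 z₀ hz₀).add (h3 z₀ hz₀)
    rw [add_zero] at hsum
    refine squeeze_zero_norm' ?_ hsum
    filter_upwards [self_mem_nhdsWithin] with z hz
    rw [fderiv_fun_smul ((hc z hz).differentiableAt one_ne_zero)
      (hf.contDiff.differentiable one_ne_zero z)]
    refine (norm_add_le _ _).trans (le_of_eq ?_)
    rw [norm_smul, Real.norm_eq_abs, ContinuousLinearMap.norm_smulRight_apply]

/-- Reciprocal distance to the origin. -/
def invNorm (z : E3 × ℝ) : ℝ := ‖z.1‖⁻¹

theorem invNorm_nonneg (z : E3 × ℝ) : 0 ≤ invNorm z := inv_nonneg.2 (norm_nonneg _)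

/-- The `i`-th component of `x / |x|`. -/
def unitCoord (i : Fin 3) (z : E3 × ℝ) : ℝ := ‖z.1‖⁻¹ * z.1 i

theorem hasFDerivAt_invNorm {z : E3 × ℝ} (hz : z.1 ≠ 0) :
    HasFDerivAt invNorm (-(‖z.1‖ ^ 3)⁻¹ •
      (∑ j, z.1 j • coord j).comp (ContinuousLinearMap.fst ℝ E3 ℝ)) z := by
  have hn : ‖z.1‖ ≠ 0 := norm_ne_zero_iff.2 hz
  have h := (hasDerivAt_inv hn).comp_hasFDerivAt z
    ((hasFDerivAt_norm hz).comp z (hasFDerivAt_fst (𝕜 := ℝ) (p := z)))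
  refine h.congr_fderiv ?_
  ext v <;> simp
  field_simp

theorem contDiffAt_invNorm {n : WithTop ℕ∞} {z : E3 × ℝ} (hz : z.1 ≠ 0) :
    ContDiffAt ℝ n invNorm z :=
  (contDiffAt_fst.norm ℝ hz).inv (norm_ne_zero_iff.2 hz)

theorem contDiffAt_unitCoord {n : WithTop ℕ∞} (i : Fin 3) {z : E3 × ℝ} (hz : z.1 ≠ 0) :
    ContDiffAt ℝ n (unitCoord i) z :=
  (contDiffAt_invNorm hz).mul ((coord i).contDiff.contDiffAt.comp z contDiffAt_fst)

theorem norm_fderiv_invNorm_le {z : E3 × ℝ} (hz : z.1 ≠ 0) :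
    ‖fderiv ℝ invNorm z‖ ≤ (‖z.1‖ ^ 2)⁻¹ := by
  have hn : 0 < ‖z.1‖ := norm_pos_iff.2 hz
  have h1 := (hasDerivAt_inv hn.ne').comp_hasFDerivAt z
    ((contDiffAt_fst.norm ℝ hz).differentiableAt one_ne_zero :
      DifferentiableAt ℝ (fun z : E3 × ℝ => ‖z.1‖) z).hasFDerivAt
  have h2 : ‖fderiv ℝ (fun z : E3 × ℝ => ‖z.1‖) z‖ ≤ 1 := by
    refine norm_fderiv_le_of_lip' ℝ zero_le_one (Filter.Eventually.of_forall fun w => ?_)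
    rw [one_mul]
    exact (abs_norm_sub_norm_le _ _).trans (norm_fst_le (w - z))
  rw [show fderiv ℝ invNorm z = _ from h1.fderiv, norm_smul, norm_neg,
    Real.norm_of_nonneg (by positivity)]
  exact mul_le_of_le_one_right (by positivity) h2

theorem hasFDerivAt_unitCoord (i : Fin 3) {z : E3 × ℝ} (hz : z.1 ≠ 0) :
    HasFDerivAt (unitCoord i) (invNorm z • (coord i).comp (ContinuousLinearMap.fst ℝ E3 ℝ)
      + z.1 i • fderiv ℝ invNorm z) z := by
  have h1 := ((contDiffAt_invNorm (n := 1) hz).differentiableAt one_ne_zero).hasFDerivAt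
  exact h1.mul ((coord i).hasFDerivAt.comp z (hasFDerivAt_fst (𝕜 := ℝ) (p := z)))

theorem norm_fderiv_unitCoord_le (i : Fin 3) {z : E3 × ℝ} (hz : z.1 ≠ 0) :
    ‖fderiv ℝ (unitCoord i) z‖ ≤ 2 * ‖z.1‖⁻¹ := by
  have hn : 0 < ‖z.1‖ := norm_pos_iff.2 hz
  rw [(hasFDerivAt_unitCoord i hz).fderiv]
  refine (norm_add_le _ _).trans ?_
  rw [norm_smul, norm_smul, two_mul]
  refine add_le_add ?_ ?_
  · rw [invNorm, Real.norm_of_nonneg (by positivity)]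
    refine mul_le_of_le_one_right (by positivity) ?_
    refine (ContinuousLinearMap.opNorm_comp_le _ _).trans ?_
    exact mul_le_one₀ (norm_coord_le i) (norm_nonneg _) (ContinuousLinearMap.norm_fst_le ℝ E3 ℝ)
  · calc ‖z.1 i‖ * ‖fderiv ℝ invNorm z‖ ≤ ‖z.1‖ * (‖z.1‖ ^ 2)⁻¹ :=
        mul_le_mul (abs_coord_le i z.1) (norm_fderiv_invNorm_le hz) (norm_nonneg _) hn.le
      _ = ‖z.1‖⁻¹ := by field_simp

theorem abs_unitCoord_le (i : Fin 3) (z : E3 × ℝ) : |unitCoord i z| ≤ 1 := by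
  rw [unitCoord, abs_mul, abs_of_nonneg (by positivity)]
  by_cases h : ‖z.1‖ = 0
  · simp [h]
  · calc ‖z.1‖⁻¹ * |z.1 i| ≤ ‖z.1‖⁻¹ * ‖z.1‖ := by gcongr; exact abs_coord_le i z.1
      _ = 1 := inv_mul_cancel₀ h

/-- A quantity `a ≤ b ‖f‖` tends to zero if `‖f‖ ≤ ε w` for every `ε` and `b w` is bounded. -/
theorem tendsto_zero_of_le_mul {F : Type*} [NormedAddCommGroup F] {l : Filter (E3 × ℝ)}
    {a w b : E3 × ℝ → ℝ} {f : E3 × ℝ → F} {C : ℝ}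
    (ha : ∀ z, 0 ≤ a z) (hab : ∀ᶠ z in l, a z ≤ b z * ‖f z‖) (hb : ∀ᶠ z in l, 0 ≤ b z)
    (hf : ∀ ε : ℝ, 0 < ε → ∀ᶠ z in l, ‖f z‖ ≤ ε * w z) (hbw : ∀ᶠ z in l, b z * w z ≤ C) :
    Filter.Tendsto a l (𝓝 0) := by
  rw [Metric.tendsto_nhds]
  intro ε hε
  have hpos : 0 < ε / (|C| + 1) := by positivity
  filter_upwards [hab, hb, hf _ hpos, hbw] with z h1 h2 h3 h4
  rw [Real.dist_eq, sub_zero, abs_of_nonneg (ha z)]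
  calc a z ≤ b z * ‖f z‖ := h1
    _ ≤ b z * (ε / (|C| + 1) * w z) := mul_le_mul_of_nonneg_left h3 h2
    _ = ε / (|C| + 1) * (b z * w z) := by ring
    _ ≤ ε / (|C| + 1) * |C| := mul_le_mul_of_nonneg_left (h4.trans (le_abs_self C)) hpos.le
    _ < ε := by
      rw [div_mul_eq_mul_div, div_lt_iff₀ (by positivity)]
      nlinarith

/-- The unit vector is bounded with gradient `O(1/|x|)`, while a flat function is `o(|x|)`. -/
theorem Flat.unitCoord_smul (i : Fin 3) {f : E3 × ℝ → F} (hf : Flat spaceProj f) :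
    Flat spaceProj fun z => unitCoord i z • f z := by
  refine hf.smul_of_tendsto (fun z hz => contDiffAt_unitCoord i (mt spaceProj_eq_zero.2 hz))
    (fun z₀ hz₀ => ?_) (fun z₀ hz₀ => ?_) fun z₀ hz₀ => ?_
  · refine squeeze_zero (fun z => by positivity)
      (fun z => mul_le_of_le_one_left (norm_nonneg _) (abs_unitCoord_le i z)) ?_
    simpa using ((hf.tendsto_zero hz₀).norm).mono_left nhdsWithin_le_nhds
  · refine squeeze_zero (fun z => by positivity)
      (fun z => mul_le_of_le_one_left (norm_nonneg _) (abs_unitCoord_le i z)) ?_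
    simpa using ((hf.tendsto_fderiv_zero hz₀).norm).mono_left nhdsWithin_le_nhds
  · refine tendsto_zero_of_le_mul (f := f) (b := fun z => 2 * ‖z.1‖⁻¹) (w := fun z => ‖z.1‖)
      (C := 2) (fun z => by positivity) ?_ (Filter.Eventually.of_forall fun z => by positivity)
      (fun ε hε => ?_) ?_
    · filter_upwards [self_mem_nhdsWithin] with z hz
      gcongr
      exact norm_fderiv_unitCoord_le i (mt spaceProj_eq_zero.2 hz)
    · filter_upwards [nhdsWithin_le_nhds (hf.eventually_norm_le spaceProj_idem hz₀ hε)] with z hz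
      rwa [norm_spaceProj] at hz
    · filter_upwards [self_mem_nhdsWithin] with z hz
      have : ‖z.1‖ ≠ 0 := norm_ne_zero_iff.2 (mt spaceProj_eq_zero.2 hz)
      rw [mul_assoc, inv_mul_cancel₀ this, mul_one]

/-- Division by `|x|` costs one order of flatness: `f = o(|x|²)` and `∇f = o(|x|)` beat `1/|x|²` and
`1/|x|`. -/
theorem Flat₂.invNorm_smul {f : E3 × ℝ → F} (hf : Flat₂ spaceProj f) :
    Flat spaceProj fun z => invNorm z • f z := by
  refine hf.flat.smul_of_tendsto (fun z hz => contDiffAt_invNorm (mt spaceProj_eq_zero.2 hz))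
    (fun z₀ hz₀ => ?_) (fun z₀ hz₀ => ?_) fun z₀ hz₀ => ?_
  · refine tendsto_zero_of_le_mul (f := f) (b := invNorm) (w := fun z => ‖z.1‖)
      (C := 1) (fun z => by positivity) ?_ (Filter.Eventually.of_forall fun z => ?_)
      (fun ε hε => ?_) ?_
    · refine Filter.Eventually.of_forall fun z => ?_
      rw [abs_of_nonneg (invNorm_nonneg z)]
    · exact invNorm_nonneg z
    · filter_upwards [nhdsWithin_le_nhds (hf.flat.eventually_norm_le spaceProj_idem hz₀ hε)]
        with z hz
      rwa [norm_spaceProj] at hz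
    · exact Filter.Eventually.of_forall fun z => inv_mul_le_one
  · refine tendsto_zero_of_le_mul (f := fderiv ℝ f) (b := invNorm) (w := fun z => ‖z.1‖)
      (C := 1) (fun z => by positivity) ?_ (Filter.Eventually.of_forall fun z => ?_)
      (fun ε hε => ?_) ?_
    · refine Filter.Eventually.of_forall fun z => ?_
      rw [abs_of_nonneg (invNorm_nonneg z)]
    · exact invNorm_nonneg z
    · filter_upwards [nhdsWithin_le_nhds (hf.flat_fderiv.eventually_norm_le spaceProj_idem hz₀ hε)]
        with z hz
      rwa [norm_spaceProj] at hz
    · exact Filter.Eventually.of_forall fun z => inv_mul_le_one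
  · refine tendsto_zero_of_le_mul (f := f) (b := fun z => (‖z.1‖ ^ 2)⁻¹) (w := fun z => ‖z.1‖ ^ 2)
      (C := 1) (fun z => by positivity) ?_ (Filter.Eventually.of_forall fun z => by positivity)
      (fun ε hε => ?_) ?_
    · filter_upwards [self_mem_nhdsWithin] with z hz
      gcongr
      exact norm_fderiv_invNorm_le (mt spaceProj_eq_zero.2 hz)
    · filter_upwards [nhdsWithin_le_nhds (hf.eventually_norm_le spaceProj_idem hz₀ hε)] with z hz
      rwa [norm_spaceProj] at hz
    · exact Filter.Eventually.of_forall fun z => inv_mul_le_one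

end UnitVector

/-- The gradient is `(x_i/|x|) ∇f + (f/|x|) e_i - Σ_j (x_i x_j/|x|²) (f/|x|) e_j`. Every term is
built from the flat functions `∇f` and `f/|x|` by multiplication with components of the unit vector,
so no second derivative has to be estimated by hand. -/
theorem Flat₂.unitCoord_smul (i : Fin 3) {f : E3 × ℝ → ℝ} (hf : Flat₂ spaceProj f) :
    Flat₂ spaceProj fun z => unitCoord i z • f z := by
  have h1 := hf.flat.unitCoord_smul i
  refine ⟨h1, ?_⟩
  let e : Fin 3 → (E3 × ℝ →L[ℝ] ℝ) := fun j => (coord j).comp (ContinuousLinearMap.fst ℝ E3 ℝ)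
  let S : Fin 3 → ℝ →L[ℝ] (E3 × ℝ →L[ℝ] ℝ) := fun j => ContinuousLinearMap.toSpanSingleton ℝ (e j)
  have ha := hf.invNorm_smul
  have hb : ∀ j, Flat spaceProj fun z => unitCoord i z • (unitCoord j z • (invNorm z • f z)) :=
    fun j => (ha.unitCoord_smul j).unitCoord_smul i
  have key : fderiv ℝ (fun z => unitCoord i z • f z) = fun z =>
      unitCoord i z • fderiv ℝ f z + (S i (invNorm z • f z)
        + ((-S 0) (unitCoord i z • (unitCoord 0 z • (invNorm z • f z)))
        + ((-S 1) (unitCoord i z • (unitCoord 1 z • (invNorm z • f z)))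
        + (-S 2) (unitCoord i z • (unitCoord 2 z • (invNorm z • f z)))))) := by
    ext1 z
    by_cases hz : spaceProj z = 0
    · rw [h1.fderiv_eq_zero z hz]
      simp [hf.flat.eq_zero z hz, hf.flat.fderiv_eq_zero z hz]
    · have hz' : z.1 ≠ 0 := mt spaceProj_eq_zero.2 hz
      have hn : ‖z.1‖ ≠ 0 := norm_ne_zero_iff.2 hz'
      refine ((hasFDerivAt_unitCoord i hz').smul
        (hf.flat.contDiff.differentiable one_ne_zero z).hasFDerivAt).fderiv.trans ?_
      rw [(hasFDerivAt_invNorm hz').fderiv]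
      congr 1
      refine ContinuousLinearMap.ext fun v => ?_
      simp [S, e, Fin.sum_univ_three, unitCoord, invNorm]
      field_simp
      ring
  rw [key]
  exact (hf.flat_fderiv.unitCoord_smul i).add ((ha.clm_comp (S i)).add
    (((hb 0).clm_comp (-S 0)).add (((hb 1).clm_comp (-S 1)).add ((hb 2).clm_comp (-S 2)))))

/-- The radial vector field `f(x,t) x/|x|` is `C²` if `f` is flat to second order at `x = 0`. -/
theorem contDiff_radialField {f : E3 × ℝ → ℝ} (hf : Flat₂ spaceProj f) :
    ContDiff ℝ 2 fun z : E3 × ℝ => f z • (‖z.1‖⁻¹ • z.1) := by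
  rw [contDiff_euclidean]
  intro i
  have h : ContDiff ℝ 2 fun z => unitCoord i z • f z := (hf.unitCoord_smul i).contDiff
  have e : (fun z : E3 × ℝ => (f z • (‖z.1‖⁻¹ • z.1)) i) = fun z => unitCoord i z • f z := by
    ext z
    simp [unitCoord, mul_comm]
  rw [e]
  exact h

/-- Radial vector fields are curl-free. -/
theorem curl_radialField {f : E3 → ℝ} (hf : Differentiable ℝ f) (hrad : RadiallySymmetric f)
    (hF : ContDiff ℝ 1 fun x : E3 => f x • (‖x‖⁻¹ • x)) (x : E3) :
    curl (fun x : E3 => f x • (‖x‖⁻¹ • x)) x = 0 := by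
  set F := fun x : E3 => f x • (‖x‖⁻¹ • x) with hFdef
  -- Off the origin the field is `κ(|x|) x` with `κ(r) = f(r e)/r`, so its Jacobian `κ I + (κ'/|x|)
  -- x xᵀ` is symmetric. The origin follows by continuity.
  have hsymm : ∀ x, x ≠ 0 → ∀ i j, partialDeriv F j i x = partialDeriv F i j x := by
    intro x hx i j
    have hn : ‖x‖ ≠ 0 := norm_ne_zero_iff.2 hx
    set e : E3 := EuclideanSpace.single 0 1 with he
    have he1 : ‖e‖ = 1 := by simp [he]
    have hprof : f = fun x => f (‖x‖ • e) := by
      ext w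
      exact hrad _ _ (by rw [norm_smul, he1, norm_norm, mul_one])
    have hline : HasDerivAt (fun r : ℝ => r⁻¹ * f (r • e))
        (deriv (fun r : ℝ => r⁻¹ * f (r • e)) ‖x‖) ‖x‖ := by
      refine DifferentiableAt.hasDerivAt (DifferentiableAt.mul (differentiableAt_inv hn) ?_)
      exact (hf _).comp _ (differentiableAt_id.smul_const e)
    set c := deriv (fun r : ℝ => r⁻¹ * f (r • e)) ‖x‖
    have hκ := hline.comp_hasFDerivAt x (hasFDerivAt_norm hx)
    have hFd := hκ.smul (hasFDerivAt_id x)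
    have hFeq : F = ((fun r : ℝ => r⁻¹ * f (r • e)) ∘ (norm : E3 → ℝ)) • (id : E3 → E3) := by
      ext1 w
      simp only [hFdef, Function.comp_apply, id, Pi.smul_apply']
      rw [smul_smul, mul_comm, ← show f w = f (‖w‖ • e) from congrFun hprof w]
    have hfd := hFd.fderiv
    rw [← hFeq] at hfd
    rw [partialDeriv, partialDeriv, hfd]
    have hs : ∀ k : Fin 3, (∑ l, x l • coord l) (EuclideanSpace.single k (1 : ℝ)) = x k := by
      intro k
      simp [coord_apply, PiLp.single_apply]
    simp only [add_apply, smul_apply,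
      ContinuousLinearMap.smulRight_apply, hs, PiLp.add_apply, PiLp.smul_apply, id,
      ContinuousLinearMap.id_apply, smul_eq_mul, PiLp.single_apply, eq_comm (a := i)]
    ring
  have hpc : ∀ i j, Continuous (partialDeriv F j i) := fun i j =>
    (coord i).continuous.comp ((hF.continuous_fderiv one_ne_zero).clm_apply continuous_const)
  have hdense : Dense ({0}ᶜ : Set E3) := dense_compl_singleton 0
  have hall : ∀ i j, partialDeriv F j i = partialDeriv F i j := fun i j =>
    Continuous.ext_on hdense (hpc i j) (hpc j i) fun x hx => hsymm x hx i j
  ext k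
  fin_cases k <;> simp [curl, hall 2 1, hall 0 2, hall 1 0]

/-! ### The amplitude as a function on space -/

section AmplitudeField

variable {p q : ℝ} (hp : 1 < p) (hpq : p < q) {σ : E3 → ℝ}
include hp hpq

theorem flat₂_defectRoot (hσ : ContDiff ℝ 2 σ) (hσ0 : σ 0 = 1) (hσ1 : ∀ x, x ≠ 0 → σ x < 1)
    (hU : TendstoZeroC2 fun x => |1 - σ x| ^ (1 / (q - 1))) :
    Flat₂ (ContinuousLinearMap.id ℝ E3) fun x => |1 - σ x| ^ (1 / (q - 1)) := by
  have hset : {z : E3 | (ContinuousLinearMap.id ℝ E3) z ≠ 0} = {0}ᶜ := by ext z; simp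
  have hexp : 1 / (q - 1) ≠ 0 := one_div_ne_zero (by linarith)
  refine flat₂_of_tendsto (fun _ => rfl) (fun z hz => ?_) (fun z hz => ?_) ?_ ?_ ?_
  · rw [show z = 0 from hz, hσ0, sub_self, abs_zero, Real.zero_rpow hexp]
  · have hne : 1 - σ z ≠ 0 := by linarith [hσ1 z hz]
    exact (((contDiffAt_const.sub hσ.contDiffAt).norm ℝ hne)).rpow_const_of_ne
      (norm_ne_zero_iff.2 hne)
  all_goals
    intro z₀ hz₀
    obtain rfl : z₀ = 0 := hz₀
    rw [hset]
  · exact hU.1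
  · exact hU.2.1
  · exact hU.2.2

theorem tendsto_amplitude (hσ : Continuous σ) (hσpos : ∀ x, 0 < σ x) (hσ0 : σ 0 = 1)
    (hσ1 : ∀ x, σ x ≤ 1) :
    Filter.Tendsto (fun x => amplitude p q (σ x)) (𝓝 0) (𝓝 0) := by
  rw [Metric.tendsto_nhds]
  intro ε hε
  have hlim : Filter.Tendsto (fun x => 2 * Real.pi * σ x) (𝓝 0) (𝓝 (2 * Real.pi)) := by
    simpa [hσ0] using (hσ.tendsto 0).const_mul (2 * Real.pi)
  have hlt : period p q ε < 2 * Real.pi := by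
    rw [← period_zero hp hpq]
    exact period_strictAntiOn hp hpq Set.self_mem_Ici hε.le hε
  filter_upwards [hlim.eventually (lt_mem_nhds hlt)] with x hx
  rw [Real.dist_eq, sub_zero, abs_of_nonneg (amplitude_nonneg hp hpq (hσpos x) (hσ1 x))]
  exact (amplitude_lt_iff hp hpq (hσpos x) (hσ1 x) hε.le).2 hx

/-- Differentiating `period R = 2π σ` and `U^(q-1) = 1 - σ`, and inserting `2π (1 - σ) = R^(p-1)
defect`, gives `U ∇R = (q-1) R (defect/rate) ∇U`. Thus `B(r) = (q-1) r β(powers r)` with `β =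
defect/rate`. Its derivative is a continuous function of the powers, hence bounded near `0`, and
`B(R)/U` is bounded because `R ≤ U` there. -/
theorem flat₂_amplitude (hσ : ContDiff ℝ 2 σ) (hσpos : ∀ x, 0 < σ x) (hσ0 : σ 0 = 1)
    (hσ1 : ∀ x, x ≠ 0 → σ x < 1)
    (hU : TendstoZeroC2 fun x => |1 - σ x| ^ (1 / (q - 1))) :
    Flat₂ (ContinuousLinearMap.id ℝ E3) fun x => amplitude p q (σ x) := by
  have hq1 : 0 < q - 1 := by linarith
  have hle : ∀ x, σ x ≤ 1 := fun x => by
    by_cases hx : x = 0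
    · rw [hx, hσ0]
    · exact (hσ1 x hx).le
  have hUflat := flat₂_defectRoot hp hpq hσ hσ0 hσ1 hU
  set U : E3 → ℝ := fun x => |1 - σ x| ^ (1 / (q - 1)) with hUdef
  have hUpos : ∀ x, x ≠ 0 → 0 < U x := fun x hx =>
    Real.rpow_pos_of_pos (abs_pos.2 (by linarith [hσ1 x hx])) _
  have hUpow : ∀ x, U x ^ (q - 1) = 1 - σ x := fun x => by
    rw [hUdef, ← Real.rpow_mul (abs_nonneg _), one_div_mul_cancel hq1.ne', Real.rpow_one,
      abs_of_nonneg (by linarith [hle x])]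
  set R : E3 → ℝ := fun x => amplitude p q (σ x) with hRdef
  have hRpos : ∀ x, x ≠ 0 → 0 < R x := fun x hx => amplitude_pos hp hpq (hσpos x) (hσ1 x hx)
  have hRlim : Filter.Tendsto R (𝓝 0) (𝓝 0) := tendsto_amplitude hp hpq hσ.continuous hσpos hσ0 hle
  have hR0 : R 0 = 0 := by rw [hRdef]; simp only [hσ0, amplitude_one hp hpq]
  have hPlim : Filter.Tendsto (fun x => powers p q (R x)) (𝓝 0) (𝓝 0) := by
    have := ((continuous_powers hp hpq).tendsto 0).comp hRlim
    rwa [powers_zero hp hpq] at this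
  have hdefect := contDiff_defect hp hpq
  have hrate := contDiff_rate hp hpq
  set β : ℝ × ℝ → ℝ := fun z => defect p q z / rate p q z with hβ
  have hβc : ContDiff ℝ 2 β := hdefect.div hrate fun z => (rate_pos hp hpq z).ne'
  have hβpos : ∀ z, 0 < β z := fun z => div_pos (defect_pos hp hpq z) (rate_pos hp hpq z)
  set D : ℝ × ℝ → ℝ := fun z => (q - 1) * (β z + fderiv ℝ β z (powersRate p q z)) with hD
  have hDc : Continuous D := by
    have h1 := hβc.continuous
    have h2 : Continuous fun z => fderiv ℝ β z (powersRate p q z) :=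
      (hβc.continuous_fderiv two_ne_zero).clm_apply (contDiff_powersRate (n := 0)).continuous
    fun_prop
  -- `R ≤ U` near the origin
  have hRU : ∀ᶠ x in 𝓝[≠] (0 : E3), R x ≤ U x := by
    have h1 : Filter.Tendsto (fun x => R x ^ (q - p)) (𝓝 0) (𝓝 0) := by
      have := ((Real.continuous_rpow_const (by linarith : 0 ≤ q - p)).tendsto 0).comp hRlim
      rwa [Real.zero_rpow (by linarith : q - p ≠ 0)] at this
    have h2 : Filter.Tendsto (fun x => defect p q (powers p q (R x)) / (2 * Real.pi)) (𝓝 0)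
        (𝓝 (defect p q 0 / (2 * Real.pi))) :=
      ((hdefect.continuous.tendsto 0).comp hPlim).div_const _
    -- `R^(q-1) = R^(p-1) R^(q-p)` and `U^(q-1) = R^(p-1) defect/(2π)`; since `q > p`, the factor
    -- `R^(q-p)` tends to `0` while the other has a positive limit.
    have h3 := h1.eventually_lt h2 (div_pos (defect_pos hp hpq 0) Real.two_pi_pos)
    filter_upwards [nhdsWithin_le_nhds h3, self_mem_nhdsWithin] with x hx hx0
    have hRx := hRpos x hx0
    rw [← Real.rpow_le_rpow_iff hRx.le (hUpos x hx0).le hq1, hUpow]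
    have h4 := one_sub_eq_amplitude hp hpq (hσpos x) (hle x)
    have h5 : R x ^ (q - 1) = R x ^ (p - 1) * R x ^ (q - p) := by
      rw [← Real.rpow_add hRx]
      congr 1
      ring
    have h6 : 1 - σ x = R x ^ (p - 1) * (defect p q (powers p q (R x)) / (2 * Real.pi)) := by
      rw [mul_div_assoc', eq_div_iff Real.two_pi_pos.ne', mul_comm]
      exact h4
    rw [h5, h6]
    exact mul_le_mul_of_nonneg_left hx.le (Real.rpow_nonneg hRx.le _)
  refine flat₂_of_smul_fderiv (B := fun r => (q - 1) * (r * β (powers p q r)))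
    (B' := fun r => D (powers p q r)) (C := (q - 1) * (β 0 + 1)) (C' := |D 0| + 1)
    hUflat hUpos ?_ hR0 (hRlim.mono_left nhdsWithin_le_nhds) hRpos ?_ ?_ ?_ ?_
  · intro x hx
    exact (contDiffAt_amplitude hp hpq (hσpos x) (hσ1 x hx)).comp x hσ.contDiffAt
  · intro r hr
    have h1 := (hβc.differentiable two_ne_zero (powers p q r)).hasFDerivAt.comp_hasDerivAt r
      (hasDerivAt_powers' (p := p) (q := q) hr)
    refine (((hasDerivAt_id r).mul h1).const_mul (q - 1)).congr_deriv ?_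
    simp only [hD, Function.comp_apply, id, one_mul, map_smul, smul_eq_mul]
    rw [mul_inv_cancel_left₀ hr.ne']
  · intro x hx
    have hRx := hRpos x hx
    have hUx := hUpos x hx
    have h1 := (hasDerivAt_amplitude hp hpq (hσpos x) (hσ1 x hx)).comp_hasFDerivAt x
      (hσ.differentiable two_ne_zero x).hasFDerivAt
    have h2 := (hUflat.flat.contDiff.differentiable one_ne_zero x).hasFDerivAt.rpow_const
      (p := q - 1) (Or.inl hUx.ne')
    have h3 : HasFDerivAt (fun x => U x ^ (q - 1)) (-fderiv ℝ σ x) x := by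
      rw [show (fun x => U x ^ (q - 1)) = fun x => 1 - σ x from funext hUpow]
      exact (hσ.differentiable two_ne_zero x).hasFDerivAt.const_sub 1
    have h4 : fderiv ℝ σ x = -(((q - 1) * U x ^ (q - 1 - 1)) • fderiv ℝ U x) := by
      rw [h2.unique h3, neg_neg]
    refine h1.fderiv.trans ?_
    rw [h4, smul_neg, ← neg_smul, smul_smul]
    congr 1
    have h5 := one_sub_eq_amplitude hp hpq (hσpos x) (hle x)
    rw [← hUpow x] at h5
    rw [Real.rpow_sub_one hUx.ne']
    change -(-(2 * Real.pi) / (R x ^ (p - 1) / R x * rate p q (powers p q (R x))))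
      * ((q - 1) * (U x ^ (q - 1) / U x))
      = (q - 1) * (R x * (defect p q (powers p q (R x)) / rate p q (powers p q (R x)))) / U x
    change 2 * Real.pi * U x ^ (q - 1) = R x ^ (p - 1) * defect p q (powers p q (R x)) at h5
    have hr := (rate_pos hp hpq (powers p q (R x))).ne'
    have hpw := (Real.rpow_pos_of_pos hRx (p - 1)).ne'
    field_simp
    linear_combination h5
  · have h1 : ∀ᶠ x in 𝓝 (0 : E3), β (powers p q (R x)) < β 0 + 1 :=
      ((hβc.continuous.tendsto 0).comp hPlim).eventually (gt_mem_nhds (by linarith))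
    filter_upwards [hRU, nhdsWithin_le_nhds h1, self_mem_nhdsWithin] with x h2 h3 hx
    have hRx := hRpos x hx
    have hUx := hUpos x hx
    have hb := hβpos (powers p q (R x))
    have hb0 := hβpos 0
    rw [abs_of_nonneg (by positivity), div_le_iff₀ hUx]
    calc (q - 1) * (R x * β (powers p q (R x))) = (q - 1) * β (powers p q (R x)) * R x := by ring
      _ ≤ (q - 1) * (β 0 + 1) * U x := by gcongr
  · have h1 : ∀ᶠ x in 𝓝 (0 : E3), |D (powers p q (R x))| < |D 0| + 1 :=
      ((hDc.abs.tendsto 0).comp hPlim).eventually (gt_mem_nhds (by linarith))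
    filter_upwards [nhdsWithin_le_nhds h1] with x hx using hx.le

/-- The amplitude inherits the exponential decay of `1 - σ`. -/
theorem exists_amplitude_mul_exp_le (hR : Continuous fun x => amplitude p q (σ x))
    (hσpos : ∀ x, 0 < σ x) (hσ1 : ∀ x, σ x ≤ 1) {γ : ℝ} (hγ : 0 < γ)
    (hdecay : BddAbove (Set.range fun x : E3 => |1 - σ x| * Real.exp (γ * (q - 1) * ‖x‖))) :
    ∃ C, 0 ≤ C ∧ ∀ x, amplitude p q (σ x) * Real.exp (γ * ‖x‖) ≤ C := by
  have hq1 : 0 < q - 1 := by linarith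
  obtain ⟨A, hA⟩ := hdecay
  have hA' : ∀ x, (1 - σ x) * Real.exp (γ * (q - 1) * ‖x‖) ≤ A := fun x => by
    have := hA ⟨x, rfl⟩
    simp only at this
    rwa [abs_of_nonneg (by linarith [hσ1 x])] at this
  have hnn : ∀ x, 0 ≤ amplitude p q (σ x) := fun x =>
    amplitude_nonneg hp hpq (hσpos x) (hσ1 x)
  -- the amplitude is bounded
  obtain ⟨r, hr⟩ : ∃ r, ∀ x : E3, r ≤ ‖x‖ → 1 / 2 ≤ σ x := by
    have hlim : Filter.Tendsto (fun r : ℝ => A * Real.exp (-(γ * (q - 1) * r))) Filter.atTop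
        (𝓝 0) := by
      have h := (Real.tendsto_exp_neg_atTop_nhds_zero.comp
        (Filter.tendsto_id.const_mul_atTop (mul_pos hγ hq1))).const_mul A
      simpa using h
    obtain ⟨r, hr⟩ := (hlim.eventually
      (gt_mem_nhds (show (0 : ℝ) < 1 / 2 by norm_num))).exists_forall_of_atTop
    refine ⟨r, fun x hx => ?_⟩
    have h1 := hr ‖x‖ hx
    have h2 : 1 - σ x ≤ A * Real.exp (-(γ * (q - 1) * ‖x‖)) := by
      rw [Real.exp_neg, ← div_eq_mul_inv, le_div_iff₀ (Real.exp_pos _)]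
      exact hA' x
    linarith
  obtain ⟨R₁, hR₁⟩ := (isCompact_closedBall (0 : E3) r).exists_bound_of_continuousOn hR.continuousOn
  -- Outside the ball `σ ≥ 1/2`, so the period is at least that of `v = 1/2`. The added `1` permits
  -- the strict comparison in `amplitude_lt_iff`.
  set R₀ := max R₁ (amplitude p q (1 / 2) + 1) with hR₀
  have hbound : ∀ x, amplitude p q (σ x) ≤ R₀ := fun x => by
    rcases le_total ‖x‖ r with hx | hx
    · exact (le_abs_self _).trans ((hR₁ x (mem_closedBall_zero_iff.2 hx)).trans (le_max_left _ _))
    · have hhalf := amplitude_nonneg hp hpq (v := 1 / 2) (by norm_num) (by norm_num)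
      refine le_trans (le_of_lt ?_) (le_max_right _ _)
      rw [amplitude_lt_iff hp hpq (hσpos x) (hσ1 x) (by linarith)]
      calc period p q (amplitude p q (1 / 2) + 1) < period p q (amplitude p q (1 / 2)) :=
            period_strictAntiOn hp hpq hhalf (Set.mem_Ici.2 (by linarith)) (by linarith)
        _ = 2 * Real.pi * (1 / 2) := period_amplitude hp hpq (by norm_num) (by norm_num)
        _ ≤ 2 * Real.pi * σ x := mul_le_mul_of_nonneg_left (hr x hx) Real.two_pi_pos.le
  -- A bound `C` of this quotient on `[0, R₀]` turns `R^(q-1) = R^(p-1) R^(q-p)` into `R^(q-1) ≤ C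
  -- R^(p-1) defect = 2π C (1 - σ)`, which has the exponent required by the decay hypothesis.
  have hg : Continuous fun r : ℝ => r ^ (q - p) / defect p q (powers p q r) :=
    (Real.continuous_rpow_const (by linarith)).div
      ((contDiff_defect hp hpq).continuous.comp (continuous_powers hp hpq))
      fun r => (defect_pos hp hpq _).ne'
  obtain ⟨C, hC⟩ := (isCompact_Icc (a := 0) (b := R₀)).exists_bound_of_continuousOn hg.continuousOn
  have hpow : ∀ x, amplitude p q (σ x) ^ (q - 1) ≤ C * (2 * Real.pi) * (1 - σ x) := by
    intro x
    have h1 := (le_abs_self _).trans (hC _ ⟨hnn x, hbound x⟩)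
    have h2 := one_sub_eq_amplitude hp hpq (hσpos x) (hσ1 x)
    have hd := defect_pos hp hpq (powers p q (amplitude p q (σ x)))
    rw [div_le_iff₀ hd] at h1
    have h3 : amplitude p q (σ x) ^ (q - 1)
        = amplitude p q (σ x) ^ (p - 1) * amplitude p q (σ x) ^ (q - p) := by
      rcases (hnn x).eq_or_lt with h | h
      · rw [← h, Real.zero_rpow hq1.ne', Real.zero_rpow (by linarith : p - 1 ≠ 0), zero_mul]
      · rw [← Real.rpow_add h]
        congr 1
        ring
    calc amplitude p q (σ x) ^ (q - 1)
        ≤ amplitude p q (σ x) ^ (p - 1)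
          * (C * defect p q (powers p q (amplitude p q (σ x)))) := by
          rw [h3]
          exact mul_le_mul_of_nonneg_left h1 (Real.rpow_nonneg (hnn x) _)
      _ = C * (2 * Real.pi) * (1 - σ x) := by linear_combination -C * h2
  have hC0 : 0 ≤ C := (norm_nonneg _).trans (hC 0 ⟨le_rfl, (hnn 0).trans (hbound 0)⟩)
  refine ⟨(C * (2 * Real.pi) * A) ^ (q - 1)⁻¹, ?_, fun x => ?_⟩
  · refine Real.rpow_nonneg ?_ _
    have hA0 : 0 ≤ A := le_trans (mul_nonneg (by linarith [hσ1 0]) (Real.exp_pos _).le) (hA' 0)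
    have := Real.pi_pos
    positivity
  · have hE := Real.exp_pos (γ * ‖x‖)
    have h0 : 0 ≤ amplitude p q (σ x) * Real.exp (γ * ‖x‖) := mul_nonneg (hnn x) hE.le
    rw [Real.le_rpow_inv_iff_of_pos h0 _ hq1, Real.mul_rpow (hnn x) hE.le, ← Real.exp_mul,
      show γ * ‖x‖ * (q - 1) = γ * (q - 1) * ‖x‖ by ring]
    · calc amplitude p q (σ x) ^ (q - 1) * Real.exp (γ * (q - 1) * ‖x‖)
          ≤ C * (2 * Real.pi) * (1 - σ x) * Real.exp (γ * (q - 1) * ‖x‖) :=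
            mul_le_mul_of_nonneg_right (hpow x) (Real.exp_pos _).le
        _ = C * (2 * Real.pi) * ((1 - σ x) * Real.exp (γ * (q - 1) * ‖x‖)) := by ring
        _ ≤ C * (2 * Real.pi) * A :=
            mul_le_mul_of_nonneg_left (hA' x) (mul_nonneg hC0 Real.two_pi_pos.le)
    · have hA0 : 0 ≤ A := le_trans (mul_nonneg (by linarith [hσ1 0]) (Real.exp_pos _).le) (hA' 0)
      have := Real.pi_pos
      positivity

end AmplitudeField

/-! ### The breather and its phase shifts -/

/-- The scalar profile `τ(x) w(σ(x) t)` of the breather. -/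
def profile (p q : ℝ) (τ σ : E3 → ℝ) (z : E3 × ℝ) : ℝ :=
  τ z.1 * wave p q (amplitude p q (σ z.1)) (σ z.1 * z.2)

/-- The radial field with the given scalar profile. -/
def radialWave (p q : ℝ) (τ σ : E3 → ℝ) (x : E3) (t : ℝ) : E3 :=
  profile p q τ σ (x, t) • (‖x‖⁻¹ • x)

theorem profile_eq_of_norm_eq {p q : ℝ} {τ σ : E3 → ℝ} (hτ : RadiallySymmetric τ)
    (hσ : RadiallySymmetric σ) {x y : E3} (h : ‖x‖ = ‖y‖) (t : ℝ) :
    profile p q τ σ (x, t) = profile p q τ σ (y, t) := by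
  simp only [profile, hτ x y h, hσ x y h]

theorem norm_inv_norm_smul {x : E3} (hx : x ≠ 0) : ‖‖x‖⁻¹ • x‖ = 1 :=
  norm_smul_inv_norm (𝕜 := ℝ) hx

theorem curl_zero (x : E3) : curl (fun _ => (0 : E3)) x = 0 := by
  ext k
  fin_cases k <;> simp [curl, partialDeriv]

theorem matCurl_of_curl_eq_zero (M : E3 → Matrix (Fin 3) (Fin 3) ℝ) {F : E3 → E3}
    (hF : ∀ x, curl F x = 0) : matCurl M F = fun _ => 0 := by
  ext1 x
  rw [matCurl, hF, map_zero]

/-- This is the role of (V): the scaling `τ` that gives the `q`-term the coefficient `μ` does the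
same for the `p`-term. Taking logarithms reduces it to linear algebra of exponents. -/
theorem vp_mul_tau_rpow {p q a v w : ℝ} (hq : q - 1 ≠ 0) (ha : 0 < a) (hw : 0 < w)
    (hv : v = (a ^ (q - p) / w ^ (1 - p)) ^ (1 / (q - 1))) :
    v * ((a / w) ^ (1 / (q - 1))) ^ (p - 1) = a := by
  have h1 : 0 < a ^ (q - p) := Real.rpow_pos_of_pos ha _
  have h2 : 0 < w ^ (1 - p) := Real.rpow_pos_of_pos hw _
  have h3 : 0 < a / w := div_pos ha hw
  have h4 := Real.rpow_pos_of_pos (div_pos h1 h2) (1 / (q - 1))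
  have h5 := Real.rpow_pos_of_pos h3 (1 / (q - 1))
  have h6 := Real.rpow_pos_of_pos h5 (p - 1)
  rw [hv]
  apply Real.log_injOn_pos (Set.mem_Ioi.2 (mul_pos h4 h6)) ha
  rw [Real.log_mul h4.ne' h6.ne', Real.log_rpow h5, Real.log_rpow h3,
    Real.log_rpow (div_pos h1 h2), Real.log_div h1.ne' h2.ne', Real.log_div ha.ne' hw.ne',
    Real.log_rpow ha, Real.log_rpow hw]
  field_simp
  ring

section Breather

variable {p q : ℝ} (hp : 1 < p) (hpq : p < q) {τ σ : E3 → ℝ}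
include hp hpq

/-- The profile is `τ · R · sin(phase(powers R, σ t))`, the shape handled by `Flat₂.smul_powers`.
The inequality `|∇R|² ≤ R` near the origin comes from nonnegativity and flatness of `R`. -/
theorem flat₂_profile (hτ : ContDiff ℝ 2 τ) (hσ : ContDiff ℝ 2 σ) (hσpos : ∀ x, 0 < σ x)
    (hσ0 : σ 0 = 1) (hσ1 : ∀ x, x ≠ 0 → σ x < 1)
    (hU : TendstoZeroC2 fun x => |1 - σ x| ^ (1 / (q - 1))) :
    Flat₂ spaceProj (profile p q τ σ) := by
  have hR := flat₂_amplitude hp hpq hσ hσpos hσ0 hσ1 hU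
  have hle : ∀ x, σ x ≤ 1 := fun x => by
    by_cases hx : x = 0
    · rw [hx, hσ0]
    · exact (hσ1 x hx).le
  have hRd := hR.flat.contDiff.differentiable one_ne_zero
  have h := hR.comp_fst.smul_powers spaceProj_idem hp hpq
    (fun z hz => amplitude_pos hp hpq (hσpos z.1) (hσ1 z.1 (mt spaceProj_eq_zero.2 hz)))
    (fun z₀ hz₀ => ⟨1, by
      have h1 := eventually_sq_norm_fderiv_le hR
        (fun x => amplitude_nonneg hp hpq (hσpos x) (hle x)) one_pos
      have h2 : Filter.Tendsto (Prod.fst : E3 × ℝ → E3) (𝓝 z₀) (𝓝 0) := by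
        have := (continuous_fst (X := E3) (Y := ℝ)).tendsto z₀
        rwa [spaceProj_eq_zero.1 hz₀] at this
      filter_upwards [h2.eventually h1] with z hz
      refine le_trans ?_ hz
      have := norm_fderiv_comp_fst_le hRd z
      gcongr⟩)
    (s := fun z => σ z.1 * z.2) ((hσ.comp contDiff_fst).mul contDiff_snd)
    (h := fun w => Real.sin (phase p q w.1 w.2))
    (Real.contDiff_sin.comp (contDiff_phase hp (hp.trans hpq)))
  have h2 := h.smul (hτ.comp (contDiff_fst (E := E3) (F := ℝ)))
  have e : profile p q τ σ = fun z : E3 × ℝ => (τ ∘ Prod.fst) z •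
      (Real.sin (phase p q (powers p q (amplitude p q (σ z.1))) (σ z.1 * z.2))
        • amplitude p q (σ z.1)) := by
    ext z
    simp only [profile, wave, Function.comp_apply, smul_eq_mul]
    ring
  rw [e]
  exact h2

theorem iteratedDeriv_two_radialWave (x : E3) (hR : 0 < amplitude p q (σ x)) (t c : ℝ) :
    iteratedDeriv 2 (fun t => radialWave p q τ σ x (t + c)) t
      = (-(τ x * σ x ^ 2 * (wave p q (amplitude p q (σ x)) (σ x * (t + c))
        + |wave p q (amplitude p q (σ x)) (σ x * (t + c))| ^ (p - 1)
          * wave p q (amplitude p q (σ x)) (σ x * (t + c))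
        + |wave p q (amplitude p q (σ x)) (σ x * (t + c))| ^ (q - 1)
          * wave p q (amplitude p q (σ x)) (σ x * (t + c))))) • (‖x‖⁻¹ • x) := by
  have hq := hp.trans hpq
  set R := amplitude p q (σ x) with hRdef
  have haff : ∀ t : ℝ, HasDerivAt (fun t => σ x * (t + c)) (σ x) t := fun t => by
    simpa using ((hasDerivAt_id t).add_const c).const_mul (σ x)
  have h1 : ∀ t, HasDerivAt (fun t => radialWave p q τ σ x (t + c))
      ((τ x * (R * (Real.cos (phase p q (powers p q R) (σ x * (t + c)))
        * speed (powers p q R) (weights p q (phase p q (powers p q R) (σ x * (t + c))))) * σ x))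
        • (‖x‖⁻¹ • x)) t := fun t =>
    (((hasDerivAt_wave hp hq R (σ x * (t + c))).comp t (haff t)).const_mul (τ x)).smul_const _
  have h2 := ((((hasDerivAt_wave_deriv hp hq hR (σ x * (t + c))).comp t (haff t)).mul_const
    (σ x)).const_mul (τ x)).smul_const (‖x‖⁻¹ • x)
  rw [iteratedDeriv_succ, iteratedDeriv_one, show deriv (fun t => radialWave p q τ σ x (t + c)) = _
    from funext fun t => (h1 t).deriv]
  refine h2.deriv.trans ?_
  congr 1
  ring

theorem exists_radialWave_eq {x : E3} (hσpos : 0 < σ x) {a : ℝ}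
    (ha : a ∈ Set.Icc (-1 : ℝ) 1) :
    ∃ s, radialWave p q τ σ x s = (τ x * (amplitude p q (σ x) * a)) • (‖x‖⁻¹ • x) := by
  obtain ⟨s, hs⟩ := exists_wave_eq hp (hp.trans hpq) (amplitude p q (σ x)) ha
  refine ⟨s / σ x, ?_⟩
  rw [radialWave, profile, mul_div_cancel₀ _ hσpos.ne', hs]

end Breather

/-- Every radial phase shift of the radial wave is a breather. -/
theorem isBreather_phaseShift_radialWave {p q : ℝ} (hp : 1 < p) (hpq : p < q)
    {ρ μ vp vq τ σ : E3 → ℝ} {M : E3 → Matrix (Fin 3) (Fin 3) ℝ}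
    (hτ : ContDiff ℝ 2 τ) (hτpos : ∀ x, 0 < τ x) (hτrad : RadiallySymmetric τ)
    (hτbdd : BddAbove (Set.range τ))
    (hσ : ContDiff ℝ 2 σ) (hσpos : ∀ x, 0 < σ x) (hσrad : RadiallySymmetric σ)
    (hσ0 : σ 0 = 1) (hσ1 : ∀ x, x ≠ 0 → σ x < 1)
    (hU : TendstoZeroC2 fun x => |1 - σ x| ^ (1 / (q - 1)))
    {γ : ℝ} (hγ : 0 < γ)
    (hdecay : BddAbove (Set.range fun x : E3 => |1 - σ x| * Real.exp (γ * (q - 1) * ‖x‖)))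
    (hρσ : ∀ x, ρ x * σ x ^ 2 = μ x) (hvp : ∀ x, vp x * τ x ^ (p - 1) = μ x)
    (hvq : ∀ x, vq x * τ x ^ (q - 1) = μ x)
    {b : E3 → ℝ} (hb : ContDiff ℝ 2 b) (hbrad : RadiallySymmetric b) :
    IsBreather ρ μ vp vq M p q (2 * Real.pi) γ (phaseShift (radialWave p q τ σ) b) := by
  have hle : ∀ x, σ x ≤ 1 := fun x => by
    by_cases hx : x = 0
    · rw [hx, hσ0]
    · exact (hσ1 x hx).le
  have hflat := flat₂_profile hp hpq hτ hσ hσpos hσ0 hσ1 hU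
  have hshift : ContDiff ℝ 2 fun z : E3 × ℝ => (z.1, z.2 + b z.1) :=
    contDiff_fst.prodMk (contDiff_snd.add (hb.comp contDiff_fst))
  have hC2 : ContDiff ℝ 2 fun z : E3 × ℝ => phaseShift (radialWave p q τ σ) b z.1 z.2 :=
    (contDiff_radialField hflat).comp hshift
  have hcurl : ∀ t, ∀ x, curl (fun x => phaseShift (radialWave p q τ σ) b x t) x = 0 := by
    intro t x
    have hslice : ContDiff ℝ 2 fun x : E3 => (x, t) := contDiff_id.prodMk contDiff_const
    refine curl_radialField (f := fun x => profile p q τ σ (x, t + b x)) ?_ ?_ ?_ x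
    · exact ((hflat.contDiff.comp hshift).comp hslice).differentiable two_ne_zero
    · intro x y hxy
      simp only [hbrad x y hxy, profile_eq_of_norm_eq hτrad hσrad hxy]
    · exact (hC2.comp hslice).of_le one_le_two
  have hmat : ∀ t, matCurl M (fun x => phaseShift (radialWave p q τ σ) b x t) = fun _ => 0 :=
    fun t => matCurl_of_curl_eq_zero M (hcurl t)
  refine ⟨⟨hC2, fun t => ?_, fun x t => ?_⟩, ?_, fun x t => ?_, ?_⟩
  · rw [hmat]
    exact differentiable_const _
  · rw [hmat, curl_zero, add_zero]
    by_cases hx : x = 0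
    · have h0 : phaseShift (radialWave p q τ σ) b x = fun _ => 0 := by
        ext1 t
        simp [phaseShift, radialWave, hx]
      rw [h0]
      simp
    · have hR := amplitude_pos hp hpq (hσpos x) (hσ1 x hx)
      have hN := norm_inv_norm_smul hx
      rw [show phaseShift (radialWave p q τ σ) b x
        = fun t => radialWave p q τ σ x (t + b x) from rfl,
        iteratedDeriv_two_radialWave hp hpq x hR]
      simp only [radialWave, profile]
      set w := wave p q (amplitude p q (σ x)) (σ x * (t + b x))
      have hnorm : ‖(τ x * w) • (‖x‖⁻¹ • x)‖ = τ x * |w| := by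
        rw [norm_smul, hN, mul_one, norm_mul, Real.norm_of_nonneg (hτpos x).le, Real.norm_eq_abs]
      rw [hnorm, Real.mul_rpow (hτpos x).le (abs_nonneg w),
        Real.mul_rpow (hτpos x).le (abs_nonneg w)]
      simp only [smul_smul, ← add_smul]
      refine smul_eq_zero_of_left ?_ x
      -- The three coefficient identities turn all coefficients into `μ`, after which the restoring
      -- forces cancel the acceleration.
      linear_combination (-‖x‖⁻¹ * τ x * (w + |w| ^ (p - 1) * w + |w| ^ (q - 1) * w)) * hρσ x
        + ‖x‖⁻¹ * τ x * |w| ^ (p - 1) * w * hvp x + ‖x‖⁻¹ * τ x * |w| ^ (q - 1) * w * hvq x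
  · obtain ⟨x, hx⟩ := exists_ne (0 : E3)
    obtain ⟨s, hs⟩ := exists_radialWave_eq hp hpq (τ := τ) (hσpos x)
      (a := 1) ⟨by norm_num, le_rfl⟩
    refine ⟨x, s - b x, ?_⟩
    rw [phaseShift, sub_add_cancel, hs, mul_one]
    have hR := amplitude_pos hp hpq (hσpos x) (hσ1 x hx)
    exact smul_ne_zero (mul_pos (hτpos x) hR).ne'
      (norm_ne_zero_iff.1 (by rw [norm_inv_norm_smul hx]; exact one_ne_zero))
  -- The amplitude was chosen so that advancing `t` by `2π` advances the argument `σ(x) t` by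
  -- exactly one period of the orbit.
  · have h := wave_add_period hp (hp.trans hpq) (amplitude p q (σ x)) (σ x * (t + b x))
    rw [← period, period_amplitude hp hpq (hσpos x) (hle x)] at h
    rw [phaseShift, phaseShift, radialWave, radialWave, profile, profile]
    simp only
    rw [← h]
    congr 4
    ring
  · obtain ⟨A, hA⟩ := hτbdd
    obtain ⟨C, hC0, hC⟩ := exists_amplitude_mul_exp_le hp hpq
      (flat₂_amplitude hp hpq hσ hσpos hσ0 hσ1 hU).contDiff.continuous hσpos hle hγ hdecay
    refine ⟨A * C, ?_⟩
    rintro _ ⟨⟨x, t⟩, rfl⟩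
    have hRnn := amplitude_nonneg hp hpq (hσpos x) (hle x)
    have h1 : ‖phaseShift (radialWave p q τ σ) b x t‖ ≤ τ x * amplitude p q (σ x) := by
      rw [phaseShift, radialWave, norm_smul, profile, norm_mul, Real.norm_of_nonneg (hτpos x).le,
        norm_smul, norm_inv, norm_norm]
      calc _ ≤ τ x * amplitude p q (σ x) * 1 := by
            refine mul_le_mul (mul_le_mul_of_nonneg_left (abs_wave_le hRnn _) (hτpos x).le)
              inv_mul_le_one (by positivity) (mul_nonneg (hτpos x).le hRnn)
        _ = _ := mul_one _
    calc ‖phaseShift (radialWave p q τ σ) b x t‖ * Real.exp (γ * ‖x‖)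
        ≤ τ x * amplitude p q (σ x) * Real.exp (γ * ‖x‖) :=
          mul_le_mul_of_nonneg_right h1 (Real.exp_pos _).le
      _ = τ x * (amplitude p q (σ x) * Real.exp (γ * ‖x‖)) := mul_assoc _ _ _
      _ ≤ A * C := mul_le_mul (hA ⟨x, rfl⟩) (hC x) (mul_nonneg hRnn (Real.exp_pos _).le)
          ((hτpos x).le.trans (hA ⟨x, rfl⟩))

end CurlCurl

end

/-! ### The main theorem -/

theorem theorem4p1 (p q : ℝ) (hp : 1 < p) (hpq : p < q)
    (ρ μ vp vq : CurlCurl.E3 → ℝ) (M : CurlCurl.E3 → Matrix (Fin 3) (Fin 3) ℝ)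
    (hρ : ContDiff ℝ 2 ρ) (hμ : ContDiff ℝ 2 μ) (hvp : ContDiff ℝ 2 vp) (hvq : ContDiff ℝ 2 vq)
    (hρ_pos : ∀ x, 0 < ρ x) (hμ_pos : ∀ x, 0 < μ x)
    (hvp_pos : ∀ x, 0 < vp x) (hvq_pos : ∀ x, 0 < vq x)
    (hρ_rad : CurlCurl.RadiallySymmetric ρ) (hμ_rad : CurlCurl.RadiallySymmetric μ)
    (hvp_rad : CurlCurl.RadiallySymmetric vp) (hvq_rad : CurlCurl.RadiallySymmetric vq)
    (hV : ∀ x, vp x = (μ x ^ (q - p) / vq x ^ (1 - p)) ^ (1 / (q - 1)))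
    (T : ℝ) (hT : T = 2 * Real.pi * CurlCurl.sigma ρ μ 0)
    (hH1 : ∀ x, x ≠ 0 → CurlCurl.sigma ρ μ 0 * CurlCurl.sigma ρ μ x < 1)
    (hH2 : CurlCurl.TendstoZeroC2
      (fun x => |1 - CurlCurl.sigma ρ μ 0 * CurlCurl.sigma ρ μ x| ^ (1 / (q - 1))))
    (γ : ℝ) (hγ : 0 < γ)
    (hH3 : BddAbove (Set.range fun x : CurlCurl.E3 =>
      |1 - CurlCurl.sigma ρ μ 0 * CurlCurl.sigma ρ μ x| * Real.exp (γ * (q - 1) * ‖x‖)))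
    (hH4 : BddAbove (Set.range (CurlCurl.tau μ vq q))) :
    T = 2 * Real.pi * √(ρ 0 / μ 0) ∧
    ∃ u : CurlCurl.E3 → ℝ → CurlCurl.E3,
      CurlCurl.IsBreather ρ μ vp vq M p q T γ u ∧
      (∃ y : ℝ → ℝ → ℝ,
        ContDiffOn ℝ 2 (fun z : ℝ × ℝ => y z.1 z.2) (Set.Ici 0 ×ˢ Set.univ) ∧
        (∀ t, u 0 t = 0) ∧ ∀ x t, x ≠ 0 → u x t = y ‖x‖ t • (‖x‖⁻¹ • x)) ∧
      (∀ b : CurlCurl.E3 → ℝ, ContDiff ℝ 2 b → CurlCurl.RadiallySymmetric b →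
        CurlCurl.IsBreather ρ μ vp vq M p q T γ (CurlCurl.phaseShift u b)) ∧
      Cardinal.continuum ≤ Cardinal.mk
        {v : CurlCurl.E3 → ℝ → CurlCurl.E3 // ∃ b : CurlCurl.E3 → ℝ,
          ContDiff ℝ 2 b ∧ CurlCurl.RadiallySymmetric b ∧ v = CurlCurl.phaseShift u b} := by
  open CurlCurl in
  have hq1 : 0 < q - 1 := by linarith
  have hquot : ContDiff ℝ 2 fun x => μ x / ρ x := hμ.div hρ fun x => (hρ_pos x).ne'
  have hσ : ContDiff ℝ 2 (sigma ρ μ) :=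
    hquot.sqrt fun x => (div_pos (hμ_pos x) (hρ_pos x)).ne'
  have hσpos : ∀ x, 0 < sigma ρ μ x := fun x => Real.sqrt_pos.2 (div_pos (hμ_pos x) (hρ_pos x))
  have hσrad : RadiallySymmetric (sigma ρ μ) := fun x y h => by
    simp only [sigma, hρ_rad x y h, hμ_rad x y h]
  have hτ : ContDiff ℝ 2 (tau μ vq q) :=
    (hμ.div hvq fun x => (hvq_pos x).ne').rpow_const_of_ne
      fun x => (div_pos (hμ_pos x) (hvq_pos x)).ne'
  have hτpos : ∀ x, 0 < tau μ vq q x := fun x =>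
    Real.rpow_pos_of_pos (div_pos (hμ_pos x) (hvq_pos x)) _
  have hτrad : RadiallySymmetric (tau μ vq q) := fun x y h => by
    simp only [tau, hvq_rad x y h, hμ_rad x y h]
  -- `U` is continuous at `0`, so its punctured limit `0` is its value `|1 - σ(0)²|^(1/(q-1))`
  -- there; positivity of `σ(0)` selects the root `1`.
  have hσ0 : sigma ρ μ 0 = 1 := by
    have hc : Continuous fun x => |1 - sigma ρ μ 0 * sigma ρ μ x| ^ (1 / (q - 1)) :=
      ((continuous_const.sub (continuous_const.mul hσ.continuous)).abs).rpow_const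
        fun x => Or.inr (by positivity)
    have h0 := tendsto_nhds_unique ((hc.tendsto 0).mono_left nhdsWithin_le_nhds) hH2.1
    simp only [Real.rpow_eq_zero (abs_nonneg _) (one_div_ne_zero hq1.ne'), abs_eq_zero] at h0
    have := hσpos 0
    nlinarith
  simp only [hσ0, one_mul] at hH1 hH2 hH3
  rw [hσ0, mul_one] at hT
  have hμρ : μ 0 / ρ 0 = 1 := Real.sqrt_eq_one.1 hσ0
  refine ⟨?_, ?_⟩
  · rw [hT, ← inv_div, hμρ, inv_one, Real.sqrt_one, mul_one]
  have hmain : ∀ b : E3 → ℝ, ContDiff ℝ 2 b → RadiallySymmetric b →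
      IsBreather ρ μ vp vq M p q T γ
        (phaseShift (radialWave p q (tau μ vq q) (sigma ρ μ)) b) := by
    intro b hb hbrad
    rw [hT]
    refine isBreather_phaseShift_radialWave hp hpq hτ hτpos hτrad hH4 hσ hσpos hσrad hσ0 hH1 hH2 hγ
      hH3 (fun x => ?_) (fun x => vp_mul_tau_rpow hq1.ne' (hμ_pos x) (hvq_pos x) (hV x))
      (fun x => ?_) hb hbrad
    · rw [sigma, Real.sq_sqrt (div_pos (hμ_pos x) (hρ_pos x)).le]
      exact mul_div_cancel₀ _ (hρ_pos x).ne'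
    · rw [tau, ← Real.rpow_mul (div_pos (hμ_pos x) (hvq_pos x)).le, one_div_mul_cancel hq1.ne',
        Real.rpow_one]
      exact mul_div_cancel₀ _ (hvq_pos x).ne'
  refine ⟨radialWave p q (tau μ vq q) (sigma ρ μ), ?_, ?_, hmain, ?_⟩
  · have h := hmain (fun _ => 0) contDiff_const fun _ _ _ => rfl
    have e : phaseShift (radialWave p q (tau μ vq q) (sigma ρ μ)) (fun _ => 0)
        = radialWave p q (tau μ vq q) (sigma ρ μ) := by
      ext1 x
      ext1 t
      simp [phaseShift]
    rwa [e] at h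
  · set e : E3 := EuclideanSpace.single 0 1 with he
    have he1 : ‖e‖ = 1 := by simp [he]
    -- The restriction of the profile to a line through the origin is `C²` on all of `ℝ × ℝ`, in
    -- particular up to `r = 0`.
    refine ⟨fun r t => profile p q (tau μ vq q) (sigma ρ μ) (r • e, t), ?_, fun t => ?_,
      fun x t _ => ?_⟩
    · have hline : ContDiff ℝ 2 fun z : ℝ × ℝ => (z.1 • e, z.2) :=
        (contDiff_fst.smul contDiff_const).prodMk contDiff_snd
      exact ((flat₂_profile hp hpq hτ hσ hσpos hσ0 hH1 hH2).contDiff.comp hline).contDiffOn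
    · simp [radialWave]
    · rw [radialWave, profile_eq_of_norm_eq hτrad hσrad (x := x) (y := ‖x‖ • e)]
      rw [norm_smul, he1, norm_norm, mul_one]
  · obtain ⟨x, hx⟩ := exists_ne (0 : E3)
    have hR := amplitude_pos hp hpq (hσpos x) (hH1 x hx)
    -- At a fixed `x ≠ 0` the orbit passes through every value `R a` with `a ∈ [-1, 1]`. Constant
    -- shifts bring these values to time `0`, so distinct `a` give distinct fields.
    choose s hs using fun a : Set.Icc (-1 : ℝ) 1 =>
      exists_radialWave_eq hp hpq (τ := tau μ vq q) (hσpos x) a.2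
    rw [← Cardinal.mk_Icc_real (show (-1 : ℝ) < 1 by norm_num)]
    refine Cardinal.mk_le_of_injective (f := fun a => ⟨phaseShift
      (radialWave p q (tau μ vq q) (sigma ρ μ)) fun _ => s a, fun _ => s a, contDiff_const,
      fun _ _ _ => rfl, rfl⟩) fun a a' haa' => ?_
    have h := congrFun (congrFun (congrArg Subtype.val haa') x) 0
    simp only [phaseShift, zero_add, hs] at h
    have hN : ‖x‖⁻¹ • x ≠ 0 :=
      norm_ne_zero_iff.1 (by rw [norm_inv_norm_smul hx]; exact one_ne_zero)
    have h1 := mul_left_cancel₀ (hτpos x).ne' (smul_left_injective ℝ hN h)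
    exact Subtype.ext (mul_left_cancel₀ hR.ne' h1)
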